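/- Let $m=2k+1$ with $k\ge 1$, let $\mu\in\{1,-1\}$, and consider the equation $$\frac{\partial u}{\partial t}=\mu\frac{\partial^m u}{\partial x^m},\qquad t>0,\ x\in\mathbb R,$$ with random initial condition $u(0,x)=\eta(x)=M(x)+\int_{\mathbb R}e^{i\lambda x}Z(d\lambda)$. Here $M$ is a deterministic locally integrable function and $Z$ is a centred complex Gaussian random measure, with finite control (spectral) measure $F$, that is symmetric around the origin ($Z(-B)=\overline{Z(B)}$), so that all fields below are real-valued. Assume that the covariance function of $\eta$ is $$\mathrm{Cov}(\eta(y),\eta(y+x))=\sum_{j=0}^{n}A_j\frac{\cos(w_jx)}{(1+x^2)^{\kappa_j/2}},\qquad x,y\in\mathbb R,$$ where $\sum_{j=0}^nA_j=1$, $w_0=0$, $w_j\ne0$ for $j\ge1$, $\kappa_j\in(0,1)$ for $0\le j\le n$, and $A_0\neq 0$. Let $u$ be a measurable version of the solution field $$u(t,x)=\int_{\mathbb R}M(x-y)\,u_m(t,y)\,dy+\frac1{2\pi}\int_{\mathbb R}e^{i(\lambda x+\mu(-1)^{(m-1)/2}\lambda^mt)}Z(d\lambda),\qquad t>0,\ x\in\mathbb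 R,$$ where $u_m(t,x)=\frac1{2\pi}\int_{\mathbb R}e^{-i\lambda x-i\mu(-1)^{(m-1)/2}t\lambda^m}d\lambda$ (improper integral) is the fundamental solution; the deterministic term of $u$ is assumed to exist (as an improper integral) and, after the rescaling $x\mapsto x/\sqrt\varepsilon$, to be integrable against the kernel $g(x_1,x)=e^{-(x_1-x)^2}$. For $\varepsilon>0$ put $$\overline U_\varepsilon^g(t,x)=\varepsilon^{-\kappa_0/4}\left[\int_{\mathbb R}g(x_1,x)\,u\Big(\tfrac{t}{\sqrt{\varepsilon^m}},\tfrac{x_1}{\sqrt\varepsilon}\Big)dx_1-\mathbb E\int_{\mathbb R}g(x_1,x)\,u\Big(\tfrac{t}{\sqrt{\varepsilon^m}},\tfrac{x_1}{\sqrt\varepsilon}\Big)dx_1\right].$$ Then, as $\varepsilon\to0+$, the finite-dimensional distributions of $\overline U_\varepsilon^g(t,x)$, $t>0$, $x\in\mathbb R$, converge weakly to those of the zero-mean Gaussian random field $$U_0^g(t,x)=\frac{\sqrt{A_0c_2(\kappa_0)}}{2\sqrt\pi}\int_{\mathbb R}\frac{e^{i(\lambda x+\mu(-1)^{(m-1)/2}\lambda^mt)}}{|\lambda|^{(1-\kappa_0)/2}}e^{-\lambda^2/4}\,W(d\lambda),\qquad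 c_2(\kappa)=\frac1{2\Gamma(\kappa)\cos(\kappa\pi/2)},$$ where $W$ is the complex Gaussian white noise on $\mathbb R$, symmetric around the origin, and $$\mathrm{Cov}(U_0^g(t,x),U_0^g(t',x'))=\frac{A_0c_2(\kappa_0)}{4\pi}\int_{\mathbb R}\frac{\cos\big(\lambda(x-x')+\mu(-1)^{(m-1)/2}(t-t')\lambda^m\big)}{|\lambda|^{1-\kappa_0}}e^{-\lambda^2/2}\,d\lambda .$$ If the factor $\frac1{2\pi}$ in front of the integral with respect to $Z$ is omitted in $u$ (so that the random part of $u$ has initial value exactly $\int e^{i\lambda x}Z(d\lambda)$), the same holds with limit field $2\pi U_0^g$. -/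

import Mathlib

open MeasureTheory ProbabilityTheory Filter Topology
open scoped ENNReal

noncomputable section

/-- The covariance function `r(x) = ∑_{j=0}^n A_j cos(w_j x) / (1 + x²)^{κ_j/2}`. -/
def cyclicCovariance {n : ℕ} (A w κ : Fin (n + 1) → ℝ) (x : ℝ) : ℝ :=
  ∑ j, A j * (Real.cos (w j * x) / (1 + x ^ 2) ^ (κ j / 2))

/-- Constraints on the parameters of `cyclicCovariance`. The sign of `A_j` is not restricted. -/
structure IsCyclicParameters {n : ℕ} (A w κ : Fin (n + 1) → ℝ) : Prop where
  sum_eq_one : ∑ j, A j = 1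
  w_zero : w 0 = 0
  w_ne_zero : ∀ j, j ≠ 0 → w j ≠ 0
  kappa_mem : ∀ j, κ j ∈ Set.Ioo (0 : ℝ) 1

/-- `c₂(κ) = (2 Γ(κ) cos(κπ/2))⁻¹`. -/
def c2 (κ : ℝ) : ℝ := (2 * Real.Gamma κ * Real.cos (κ * Real.pi / 2))⁻¹

/-- `Z` is a centred complex Gaussian random measure on `ℝ` with control measure `F`
(`E Z(A) conj Z(B) = F(A ∩ B)` on Borel sets of finite `F`-measure), symmetric around the origin:
`Z(-A) = conj Z(A)` almost surely. Joint Gaussianity is that of the real and imaginary parts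
(`ℂ` is regarded as a real vector space). Additivity (in mean square) follows from the
covariance. For `F = volume` this is the symmetric complex Gaussian white noise. -/
structure IsGaussianRandomMeasure {Ω : Type*} [MeasurableSpace Ω] (P : Measure Ω)
    (F : Measure ℝ) (Z : Set ℝ → Ω → ℂ) : Prop where
  gaussian : IsGaussianProcess (fun A : {A : Set ℝ // MeasurableSet A ∧ F A < ∞} => Z A.1) P
  mean_zero : ∀ A, MeasurableSet A → F A < ∞ → ∫ ω, Z A ω ∂P = 0
  covariance_eq : ∀ A B, MeasurableSet A → F A < ∞ → MeasurableSet B → F B < ∞ →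
    ∫ ω, Z A ω * (starRingEnd ℂ) (Z B ω) ∂P = ((F (A ∩ B)).toReal : ℂ)
  symm : ∀ A, MeasurableSet A → F A < ∞ → F ((fun l : ℝ => -l) ⁻¹' A) < ∞ →
    ∀ᵐ ω ∂P, Z ((fun l : ℝ => -l) ⁻¹' A) ω = (starRingEnd ℂ) (Z A ω)

/-- `Y = ∫ φ(l) Z(dl)` almost surely, the integral being the `L²(Ω)`-limit of the integrals
`∑ c_A Z(A)` of step functions `∑ c_A 1_A` that converge to `φ` in `L²(F)`. -/
def HasStochIntegral {Ω : Type*} [MeasurableSpace Ω] (P : Measure Ω)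
    (F : Measure ℝ) (Z : Set ℝ → Ω → ℂ) (φ : ℝ → ℂ) (Y : Ω → ℂ) : Prop :=
  MemLp φ 2 F ∧ MemLp Y 2 P ∧
    ∀ δ : ℝ≥0∞, 0 < δ → ∃ (s : Finset (Set ℝ)) (c : Set ℝ → ℂ),
      (∀ A ∈ s, MeasurableSet A ∧ F A < ∞) ∧
      eLpNorm (fun l => φ l - ∑ A ∈ s, c A * A.indicator (fun _ => (1 : ℂ)) l) 2 F < δ ∧
      eLpNorm (fun ω => Y ω - ∑ A ∈ s, c A * Z A ω) 2 P < δ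

/-- The phase `l x + μ (-1)^{(m-1)/2} l^m t` (used for odd `m` only). -/
def phase (μ : ℝ) (m : ℕ) (t x l : ℝ) : ℝ :=
  l * x + μ * (-1) ^ ((m - 1) / 2) * l ^ m * t

/-- The fundamental solution `(1/2π) ∫ exp(-i l x - i μ (-1)^{(m-1)/2} t l^m) dl` of
`∂u/∂t = μ ∂^m u/∂x^m`; the integral is improper (not absolutely convergent), and its value
is real. -/
def fundamentalSolution (μ : ℝ) (m : ℕ) (t x : ℝ) : ℝ :=
  (limUnder atTop (fun R : ℝ =>
    (1 / (2 * Real.pi) : ℂ) *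
      ∫ l in (-R)..R, Complex.exp (-(Complex.I * (phase μ m t x l : ℂ))))).re

/-- `mean t x = ∫ M(x - y) u_m(t, y) dy` for all `t > 0` and `x`, where `u_m` is the
fundamental solution; as for `u_m` itself, the integral is allowed to converge only as an
improper one. -/
def IsMeanField (μ : ℝ) (m : ℕ) (M : ℝ → ℝ) (mean : ℝ → ℝ → ℝ) : Prop :=
  LocallyIntegrable M ∧ ∀ t, 0 < t → ∀ x,
    Tendsto (fun R : ℝ => ∫ y in (-R)..R, M (x - y) * fundamentalSolution μ m t y)
      atTop (𝓝 (mean t x))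

/-- `u` is a (measurable version of the) random field
`u(t,x) = mean(t,x) + c ∫ exp(i (l x + μ (-1)^{(m-1)/2} l^m t)) Z(dl)`, `t > 0`, `x ∈ ℝ`. -/
structure IsSolutionField {Ω : Type*} [MeasurableSpace Ω] (P : Measure Ω)
    (F : Measure ℝ) (Z : Set ℝ → Ω → ℂ) (c μ : ℝ) (m : ℕ) (mean : ℝ → ℝ → ℝ)
    (u : ℝ → ℝ → Ω → ℝ) : Prop where
  measurable : ∀ t, 0 < t → Measurable (fun p : ℝ × Ω => u t p.1 p.2)
  spectral : ∀ t, 0 < t → ∀ x, HasStochIntegral P F Z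
    (fun l => (c : ℂ) * Complex.exp (Complex.I * (phase μ m t x l : ℂ)))
    (fun ω => ((u t x ω - mean t x : ℝ) : ℂ))

/-- The kernel average `∫ exp(-(x₁ - x)²) u(t/√(ε^m), x₁/√ε) dx₁`. -/
def kernelAverage {Ω : Type*} (m : ℕ) (u : ℝ → ℝ → Ω → ℝ) (ε t x : ℝ) (ω : Ω) : ℝ :=
  ∫ x₁, Real.exp (-(x₁ - x) ^ 2) * u (t / √(ε ^ m)) (x₁ / √ε) ω

/-- The centred kernel average, multiplied by `ε^{-κ₀/4}`. -/
def rescaledAverage {Ω : Type*} [MeasurableSpace Ω] (P : Measure Ω) (κ₀ : ℝ) (m : ℕ)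
    (u : ℝ → ℝ → Ω → ℝ) (ε t x : ℝ) (ω : Ω) : ℝ :=
  ε ^ (-κ₀ / 4) * (kernelAverage m u ε t x ω - ∫ ω', kernelAverage m u ε t x ω' ∂P)

/-- Weak convergence, as `ε → 0+`, of the finite-dimensional distributions of random fields
indexed by `t > 0`, `x ∈ ℝ`. -/
def TendstoFDD {Ω Ω' : Type*} [MeasurableSpace Ω] [MeasurableSpace Ω']
    (P : Measure Ω) [IsProbabilityMeasure P] (P' : Measure Ω') [IsProbabilityMeasure P']
    (X : ℝ → ℝ → ℝ → Ω → ℝ) (U : ℝ → ℝ → Ω' → ℝ) : Prop :=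
  ∀ (N : ℕ) (t x : Fin N → ℝ), (∀ i, 0 < t i) →
    TendstoInDistribution
      (fun (ε : Set.Ioi (0 : ℝ)) (ω : Ω) (i : Fin N) => X ε (t i) (x i) ω)
      (comap Subtype.val (𝓝 (0 : ℝ)))
      (fun (ω : Ω') (i : Fin N) => U (t i) (x i) ω) (fun _ => P) P'

end

noncomputable section

/-! ### The Gaussian Hilbert space of a Gaussian random measure -/

/-! Everything is centred Gaussian, so only covariances matter. Stochastic integrals with real
values lie in the closed real span of the variables Re(z Z(A)), and so do their averages over x.
Every element of that space is a centred Gaussian variable, hence finite families are jointly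
Gaussian. Convergence of finite-dimensional distributions thus reduces to convergence of covariances
(`tendstoInDistribution_of_inGaussianSpace`).

The kernel is √π times the density of N(x, 1/2). By the isometry and Fubini, the scalings of t and x
combine so that the covariance of two rescaled averages is c²π δ^(-κ₀) ∫ G(l/δ) F(dl), with δ = √ε
and G the fixed function `averageKernel`, of modulus exp(-l²/2). What remains is the behaviour of F
near the origin (`tendsto_integral_comp_div`).

The covariance of η identifies the characteristic function of F. The Gamma integral writes
(1+x²)^(-κ/2) as a mixture of the functions exp(-s x²), which are characteristic functions of N(0,
2s). Its spectral density is therefore the explicit mixture `gammaMixtureDensity κ 1`, and the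
cosines shift it by ±w_j. Rescaling frequencies by δ replaces the parameter d = 1 by d = δ², and as
d → 0 the mixture tends from below to the Riesz density c₂(κ)|l|^(κ-1). Dominated convergence gives
the term j = 0. The terms j ≠ 0 have their singularities at ±w_j, away from the origin, and
contribute O(δ), which is negligible against δ^(κ₀) because κ₀ < 1, whatever κ_j is. -/

/-- The closed real span, in `L²(P)`, of the real and imaginary parts of the values of `Z`. -/
def gaussianSpace {Ω : Type*} [MeasurableSpace Ω] (P : Measure Ω) (F : Measure ℝ)
    (Z : Set ℝ → Ω → ℂ) : Submodule ℝ (Lp ℝ 2 P) :=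
  (Submodule.span ℝ {f : Lp ℝ 2 P | ∃ (A : Set ℝ) (z : ℂ), MeasurableSet A ∧ F A < ∞ ∧
    f =ᵐ[P] fun ω => (z * Z A ω).re}).topologicalClosure

section GaussianSpace

variable {Ω : Type*} [MeasurableSpace Ω] {P : Measure Ω} [IsProbabilityMeasure P]
  {F : Measure ℝ} {Z : Set ℝ → Ω → ℂ}

/-- From |exp(ia) - exp(ib)| ≤ |a - b| and the fact that the L¹ norm is at most the L² norm under a
probability measure. This continuity lets Gaussianity pass to L² limits. -/
lemma lipschitzWith_integral_exp_I_mul :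
    LipschitzWith 1 (fun f : Lp ℝ 2 P => ∫ ω, Complex.exp (Complex.I * (f ω : ℂ)) ∂P) := by
  have hint : ∀ f : Lp ℝ 2 P, Integrable (fun ω => Complex.exp (Complex.I * (f ω : ℂ))) P := by
    intro f
    refine Integrable.of_bound (C := 1) ?_ (ae_of_all _ fun ω => ?_)
    · have := (Lp.aestronglyMeasurable f).aemeasurable
      exact AEMeasurable.aestronglyMeasurable (by fun_prop)
    · rw [mul_comm, Complex.norm_exp_ofReal_mul_I]
  intro f g
  simp only [ENNReal.coe_one, one_mul]
  rw [edist_eq_enorm_sub, ← integral_sub (hint f) (hint g)]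
  refine (enorm_integral_le_lintegral_enorm _).trans ?_
  have h1 : ∫⁻ ω, ‖Complex.exp (Complex.I * (f ω : ℂ)) - Complex.exp (Complex.I * (g ω : ℂ))‖ₑ ∂P
      ≤ ∫⁻ ω, ‖f ω - g ω‖ₑ ∂P := by
    refine lintegral_mono fun ω => ?_
    have h2 : Complex.exp (Complex.I * (f ω : ℂ)) - Complex.exp (Complex.I * (g ω : ℂ))
        = Complex.exp (Complex.I * (g ω : ℂ)) *
          (Complex.exp (Complex.I * ((f ω - g ω : ℝ) : ℂ)) - 1) := by
      rw [mul_sub, ← Complex.exp_add]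
      congr 2
      · push_cast; ring
      · ring
    rw [h2, enorm_mul]
    have h3 : ‖Complex.exp (Complex.I * (g ω : ℂ))‖ₑ = 1 := by
      rw [← ofReal_norm, mul_comm, Complex.norm_exp_ofReal_mul_I, ENNReal.ofReal_one]
    rw [h3, one_mul]
    exact Real.enorm_exp_I_mul_ofReal_sub_one_le
  refine h1.trans ?_
  rw [Lp.edist_def]
  have h4 := eLpNorm_le_eLpNorm_of_exponent_le (p := 1) (q := 2) (μ := P)
    (f := ⇑f - ⇑g) (by norm_num)
    ((Lp.aestronglyMeasurable f).sub (Lp.aestronglyMeasurable g))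
  rw [eLpNorm_one_eq_lintegral_enorm] at h4
  exact h4

/-- The elements of `L²(P)` whose characteristic function at `1` is that of a centred Gaussian
variable with the same variance form a closed set. -/
lemma isClosed_setOf_integral_exp_eq :
    IsClosed {f : Lp ℝ 2 P | ∫ ω, Complex.exp (Complex.I * (f ω : ℂ)) ∂P =
      Complex.exp (-((‖f‖ ^ 2 / 2 : ℝ) : ℂ))} :=
  isClosed_eq lipschitzWith_integral_exp_I_mul.continuous (by fun_prop)

omit [IsProbabilityMeasure P] in
lemma norm_sq_Lp_two_eq (f : Lp ℝ 2 P) : ‖f‖ ^ 2 = ∫ ω, f ω ^ 2 ∂P := by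
  rw [← real_inner_self_eq_norm_sq, L2.inner_def]
  congr 1
  ext ω
  simp [pow_two]

omit [IsProbabilityMeasure P] in
lemma integral_exp_of_hasGaussianLaw {f : Lp ℝ 2 P} (hf : HasGaussianLaw f P)
    (h0 : ∫ ω, f ω ∂P = 0) :
    ∫ ω, Complex.exp (Complex.I * (f ω : ℂ)) ∂P = Complex.exp (-((‖f‖ ^ 2 / 2 : ℝ) : ℂ)) := by
  have h := hf.charFun_map_eq 1
  rw [charFun_apply_real, integral_map hf.aemeasurable (by fun_prop)] at h
  have hv : Var[fun ω => inner ℝ (1 : ℝ) (f ω); P] = ‖f‖ ^ 2 := by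
    rw [norm_sq_Lp_two_eq, ← variance_of_integral_eq_zero hf.aemeasurable h0]
    simp
  have hm : P[fun ω => inner ℝ (1 : ℝ) (f ω)] = 0 := by simpa using h0
  rw [hv, hm] at h
  calc _ = _ := by
        congr 1; ext ω; congr 1; simp; ring
    _ = _ := h
    _ = _ := by congr 1; push_cast; ring

namespace IsGaussianRandomMeasure

omit [IsProbabilityMeasure P] in
lemma memLp_two (hZ : IsGaussianRandomMeasure P F Z) {A : Set ℝ} (hA : MeasurableSet A)
    (hFA : F A < ∞) : MemLp (Z A) 2 P :=
  (hZ.gaussian.hasGaussianLaw_eval ⟨A, hA, hFA⟩).memLp_two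

omit [IsProbabilityMeasure P] in
lemma isGaussianProcess_re_mul (hZ : IsGaussianRandomMeasure P F Z) {ι : Type*}
    (A : ι → {A : Set ℝ // MeasurableSet A ∧ F A < ∞}) (z : ι → ℂ) :
    IsGaussianProcess (fun i ω => (z i * Z (A i).1 ω).re) P :=
  (hZ.gaussian.comp_right A).comp_left
    (fun i => Complex.reCLM ∘L (ContinuousLinearMap.mul ℝ ℂ (z i)))

lemma integral_re_mul (hZ : IsGaussianRandomMeasure P F Z) {A : Set ℝ} (hA : MeasurableSet A)
    (hFA : F A < ∞) (z : ℂ) : ∫ ω, (z * Z A ω).re ∂P = 0 := by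
  have h := integral_re (μ := P) (f := fun ω => z * Z A ω)
    (((hZ.memLp_two hA hFA).integrable (by norm_num)).const_mul z)
  rw [integral_const_mul, hZ.mean_zero A hA hFA] at h
  simpa using h

/-- On the span the identity is the joint Gaussianity of Z applied to a finite sum; it defines a
closed set, so it extends to the closure. -/
lemma integral_exp_eq_of_mem_gaussianSpace (hZ : IsGaussianRandomMeasure P F Z) {f : Lp ℝ 2 P}
    (hf : f ∈ gaussianSpace P F Z) :
    ∫ ω, Complex.exp (Complex.I * (f ω : ℂ)) ∂P = Complex.exp (-((‖f‖ ^ 2 / 2 : ℝ) : ℂ)) := by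
  rw [gaussianSpace, ← SetLike.mem_coe, Submodule.topologicalClosure_coe] at hf
  refine closure_minimal ?_ isClosed_setOf_integral_exp_eq hf
  intro f hf
  obtain ⟨n, a, g, rfl⟩ := Submodule.mem_span_set'.1 hf
  choose A z hA hFA hg using fun i => (g i).2
  have hae : ((∑ i, a i • (g i : Lp ℝ 2 P) : Lp ℝ 2 P) : Ω → ℝ) =ᵐ[P]
      fun ω => ∑ i, ((a i * z i) * Z (A i) ω).re := by
    have h1 := Lp.coeFn_finsetSum (Finset.univ) (fun i => a i • (g i : Lp ℝ 2 P))
    have h2 : ∀ᵐ ω ∂P, ∀ i, (a i • (g i : Lp ℝ 2 P) : Lp ℝ 2 P) ω =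
        ((a i * z i) * Z (A i) ω).re := by
      rw [ae_all_iff]
      intro i
      filter_upwards [Lp.coeFn_smul (a i) (g i : Lp ℝ 2 P), hg i] with ω h3 h4
      rw [h3, Pi.smul_apply, h4, mul_assoc, Complex.re_ofReal_mul, smul_eq_mul]
    filter_upwards [h1, h2] with ω h3 h4
    rw [h3, Finset.sum_apply]
    exact Finset.sum_congr rfl fun i _ => h4 i
  refine integral_exp_of_hasGaussianLaw (HasGaussianLaw.congr
    (hZ.isGaussianProcess_re_mul (fun i => ⟨A i, hA i, hFA i⟩)
      (fun i => a i * z i)).hasGaussianLaw_fun_sum hae.symm) ?_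
  rw [integral_congr_ae hae, integral_finsetSum]
  · exact Finset.sum_eq_zero fun i _ => hZ.integral_re_mul (hA i) (hFA i) _
  · intro i _
    exact (((hZ.memLp_two (hA i) (hFA i)).integrable (by norm_num)).const_mul _).re

/-- The elements of the Gaussian space are centred Gaussian variables. -/
lemma map_eq_gaussianReal (hZ : IsGaussianRandomMeasure P F Z) {f : Lp ℝ 2 P}
    (hf : f ∈ gaussianSpace P F Z) : P.map f = gaussianReal 0 (‖f‖ ^ 2).toNNReal := by
  have : IsProbabilityMeasure (P.map f) :=
    Measure.isProbabilityMeasure_map (Lp.aestronglyMeasurable f).aemeasurable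
  refine Measure.ext_of_charFun ?_
  ext t
  rw [charFun_apply_real, integral_map (Lp.aestronglyMeasurable f).aemeasurable (by fun_prop),
    charFun_gaussianReal]
  -- The characteristic function of f at t is that of t • f at 1, and t • f stays in the space.
  have h := hZ.integral_exp_eq_of_mem_gaussianSpace (Submodule.smul_mem _ t hf)
  rw [norm_smul] at h
  calc _ = ∫ ω, Complex.exp (Complex.I * ((t • f : Lp ℝ 2 P) ω : ℂ)) ∂P := by
        refine integral_congr_ae ?_
        filter_upwards [Lp.coeFn_smul t f] with ω hω
        rw [hω]
        congr 1
        simp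
        ring
    _ = _ := h
    _ = _ := by
        congr 1
        rw [Real.coe_toNNReal _ (by positivity), mul_pow, Real.norm_eq_abs, sq_abs]
        push_cast
        ring

end IsGaussianRandomMeasure

end GaussianSpace

/-! ### Stochastic integrals: membership in the Gaussian space and the isometry -/

section StochIntegral

variable {Ω : Type*} [MeasurableSpace Ω] {P : Measure Ω}
  {F : Measure ℝ} {Z : Set ℝ → Ω → ℂ}

lemma HasStochIntegral.memLp_of_ofReal {φ : ℝ → ℂ} {y : Ω → ℝ}
    (h : HasStochIntegral P F Z φ (fun ω => (y ω : ℂ))) : MemLp y 2 P := by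
  simpa using h.2.1.re

/-- Since y is real, replacing the approximating sums by their real parts does not increase the
distance to y, and these real parts lie in the span. -/
lemma HasStochIntegral.toLp_mem_gaussianSpace (hZ : IsGaussianRandomMeasure P F Z) {φ : ℝ → ℂ}
    {y : Ω → ℝ} (h : HasStochIntegral P F Z φ (fun ω => (y ω : ℂ))) :
    h.memLp_of_ofReal.toLp y ∈ gaussianSpace P F Z := by
  rw [gaussianSpace, ← SetLike.mem_coe, Submodule.topologicalClosure_coe, EMetric.mem_closure_iff]
  intro δ hδ
  obtain ⟨s, c, hs, -, hY⟩ := h.2.2 δ hδ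
  have hG : ∀ A : s, MemLp (fun ω => (c A * Z A ω).re) 2 P := fun A =>
    ((hZ.memLp_two (hs A A.2).1 (hs A A.2).2).const_mul (c A)).re
  refine ⟨∑ A : s, (hG A).toLp _, ?_, ?_⟩
  · refine Submodule.sum_mem _ fun A _ => Submodule.subset_span ?_
    exact ⟨A, c A, (hs A A.2).1, (hs A A.2).2, (hG A).coeFn_toLp⟩
  · refine lt_of_le_of_lt ?_ hY
    rw [Lp.edist_def]
    refine eLpNorm_mono_ae ?_
    have h2 : ∀ᵐ ω ∂P, ∀ A : s, (hG A).toLp _ ω = (c A * Z A ω).re := by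
      rw [ae_all_iff]
      exact fun A => (hG A).coeFn_toLp
    filter_upwards [Lp.coeFn_finsetSum Finset.univ (fun A : s => (hG A).toLp _), h2,
      h.memLp_of_ofReal.coeFn_toLp] with ω h3 h4 h5
    rw [Pi.sub_apply, h3, h5, Finset.sum_apply, Finset.sum_congr rfl fun A _ => h4 A]
    rw [Finset.sum_coe_sort s (fun A => (c A * Z A ω).re), ← Complex.re_sum]
    refine le_trans (le_of_eq ?_) (Complex.abs_re_le_norm _)
    simp

/-- Stated for an arbitrary family X so that it serves twice: for Z under P and for indicators under
F. -/
lemma integral_sum_sum_mul_conj {α : Type*} [MeasurableSpace α] (ρ : Measure α)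
    (X : Set ℝ → α → ℂ) (s s' : Finset (Set ℝ)) (c c' : Set ℝ → ℂ)
    (hX : ∀ A ∈ s, MemLp (X A) 2 ρ) (hX' : ∀ A ∈ s', MemLp (X A) 2 ρ) :
    ∫ a, (∑ A ∈ s, c A * X A a) * (starRingEnd ℂ) (∑ B ∈ s', c' B * X B a) ∂ρ
      = ∑ A ∈ s, ∑ B ∈ s', c A * (starRingEnd ℂ) (c' B) *
        ∫ a, X A a * (starRingEnd ℂ) (X B a) ∂ρ := by
  simp_rw [map_sum, Finset.sum_mul_sum, map_mul]
  have hint : ∀ A ∈ s, ∀ B ∈ s', Integrable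
      (fun a => c A * X A a * ((starRingEnd ℂ) (c' B) * (starRingEnd ℂ) (X B a))) ρ := by
    intro A hA B hB
    exact ((hX A hA).const_mul (c A)).integrable_mul ((hX' B hB).star.const_mul _)
  rw [integral_finsetSum _ fun A hA => integrable_finsetSum _ fun B hB => hint A hA B hB]
  refine Finset.sum_congr rfl fun A hA => ?_
  rw [integral_finsetSum _ fun B hB => hint A hA B hB]
  refine Finset.sum_congr rfl fun B hB => ?_
  rw [← integral_const_mul]
  congr 1
  ext a
  ring

/-- The isometry on step functions. Both sides expand sesquilinearly and agree term by term through
F(A ∩ B), so the sets need not be disjoint. -/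
lemma IsGaussianRandomMeasure.integral_sum_mul_conj_sum (hZ : IsGaussianRandomMeasure P F Z)
    (s s' : Finset (Set ℝ)) (c c' : Set ℝ → ℂ) (hs : ∀ A ∈ s, MeasurableSet A ∧ F A < ∞)
    (hs' : ∀ A ∈ s', MeasurableSet A ∧ F A < ∞) :
    ∫ ω, (∑ A ∈ s, c A * Z A ω) * (starRingEnd ℂ) (∑ B ∈ s', c' B * Z B ω) ∂P =
    ∫ l, (∑ A ∈ s, c A * A.indicator (fun _ => (1 : ℂ)) l) *
      (starRingEnd ℂ) (∑ B ∈ s', c' B * B.indicator (fun _ => (1 : ℂ)) l) ∂F := by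
  rw [integral_sum_sum_mul_conj P Z _ _ _ _ (fun A hA => hZ.memLp_two (hs A hA).1 (hs A hA).2)
      (fun A hA => hZ.memLp_two (hs' A hA).1 (hs' A hA).2),
    integral_sum_sum_mul_conj F (fun A l => A.indicator (fun _ => (1 : ℂ)) l) _ _ _ _
      (fun A hA => memLp_indicator_const 2 (hs A hA).1 1 (Or.inr (hs A hA).2.ne))
      (fun A hA => memLp_indicator_const 2 (hs' A hA).1 1 (Or.inr (hs' A hA).2.ne))]
  refine Finset.sum_congr rfl fun A hA => Finset.sum_congr rfl fun B hB => ?_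
  rw [hZ.covariance_eq A B (hs A hA).1 (hs A hA).2 (hs' B hB).1 (hs' B hB).2]
  congr 1
  have : (fun l => A.indicator (fun _ => (1 : ℂ)) l *
      (starRingEnd ℂ) (B.indicator (fun _ => (1 : ℂ)) l)) = (A ∩ B).indicator (fun _ => 1) := by
    ext l
    by_cases h1 : l ∈ A <;> by_cases h2 : l ∈ B <;> simp [h1, h2]
  rw [this, integral_indicator_const _ ((hs A hA).1.inter (hs' B hB).1)]
  simp [Measure.real]

/-- Tolerances 1/(n+1) are used. The point is that the same sets and coefficients approximate the
integrand and the integral simultaneously. -/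
lemma HasStochIntegral.exists_tendsto (hZ : IsGaussianRandomMeasure P F Z) {φ : ℝ → ℂ}
    {Y : Ω → ℂ} (h : HasStochIntegral P F Z φ Y) :
    ∃ (s : ℕ → Finset (Set ℝ)) (c : ℕ → Set ℝ → ℂ)
      (_ : ∀ n, ∀ A ∈ s n, MeasurableSet A ∧ F A < ∞)
      (h1 : ∀ n, MemLp (fun l => ∑ A ∈ s n, c n A * A.indicator (fun _ => (1 : ℂ)) l) 2 F)
      (h2 : ∀ n, MemLp (fun ω => ∑ A ∈ s n, c n A * Z A ω) 2 P),
      Tendsto (fun n => (h1 n).toLp _) atTop (𝓝 (h.1.toLp φ)) ∧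
      Tendsto (fun n => (h2 n).toLp _) atTop (𝓝 (h.2.1.toLp Y)) := by
  have hpos : ∀ n : ℕ, (0 : ℝ≥0∞) < (n + 1 : ℝ≥0∞)⁻¹ := fun n =>
    ENNReal.inv_pos.2 (by simp)
  choose s c hs hφ hY using fun n : ℕ => h.2.2 _ (hpos n)
  have hlim : Tendsto (fun n : ℕ => (n + 1 : ℝ≥0∞)⁻¹) atTop (𝓝 0) := by
    have := ENNReal.tendsto_inv_nat_nhds_zero.comp (tendsto_add_atTop_nat 1)
    refine this.congr fun n => ?_
    simp
  have h1 : ∀ n, MemLp (fun l => ∑ A ∈ s n, c n A * A.indicator (fun _ => (1 : ℂ)) l) 2 F :=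
    fun n => memLp_finsetSum _ fun A hA =>
      (memLp_indicator_const 2 (hs n A hA).1 1 (Or.inr (hs n A hA).2.ne)).const_mul _
  have h2 : ∀ n, MemLp (fun ω => ∑ A ∈ s n, c n A * Z A ω) 2 P :=
    fun n => memLp_finsetSum _ fun A hA =>
      (hZ.memLp_two (hs n A hA).1 (hs n A hA).2).const_mul _
  refine ⟨s, c, hs, h1, h2, ?_, ?_⟩
  · rw [tendsto_iff_edist_tendsto_0]
    refine tendsto_of_tendsto_of_tendsto_of_le_of_le tendsto_const_nhds hlim
      (fun _ => zero_le) (fun n => ?_)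
    rw [edist_comm, Lp.edist_toLp_toLp]
    exact (hφ n).le
  · rw [tendsto_iff_edist_tendsto_0]
    refine tendsto_of_tendsto_of_tendsto_of_le_of_le tendsto_const_nhds hlim
      (fun _ => zero_le) (fun n => ?_)
    rw [edist_comm, Lp.edist_toLp_toLp]
    exact (hY n).le

lemma inner_toLp_eq {α : Type*} [MeasurableSpace α] {ρ : Measure α} {f g : α → ℂ}
    (hf : MemLp f 2 ρ) (hg : MemLp g 2 ρ) :
    inner ℂ (hg.toLp g) (hf.toLp f) = ∫ a, f a * (starRingEnd ℂ) (g a) ∂ρ := by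
  rw [L2.inner_def]
  refine integral_congr_ae ?_
  filter_upwards [hf.coeFn_toLp, hg.coeFn_toLp] with a h1 h2
  rw [h1, h2]
  simp

/-- The isometry property of stochastic integrals. -/
lemma HasStochIntegral.integral_mul_conj (hZ : IsGaussianRandomMeasure P F Z) {φ ψ : ℝ → ℂ}
    {X Y : Ω → ℂ} (hX : HasStochIntegral P F Z φ X) (hY : HasStochIntegral P F Z ψ Y) :
    ∫ ω, X ω * (starRingEnd ℂ) (Y ω) ∂P = ∫ l, φ l * (starRingEnd ℂ) (ψ l) ∂F := by
  obtain ⟨s, c, hs, h1, h2, hl1, hl2⟩ := hX.exists_tendsto hZ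
  obtain ⟨s', c', hs', h1', h2', hl1', hl2'⟩ := hY.exists_tendsto hZ
  rw [← inner_toLp_eq hX.2.1 hY.2.1, ← inner_toLp_eq hX.1 hY.1]
  refine tendsto_nhds_unique (hl2'.inner hl2) ((hl1'.inner hl1).congr fun n => ?_)
  rw [inner_toLp_eq, inner_toLp_eq]
  exact (hZ.integral_sum_mul_conj_sum _ _ _ _ (hs n) (hs' n)).symm

lemma HasStochIntegral.integral_mul_eq (hZ : IsGaussianRandomMeasure P F Z) {φ ψ : ℝ → ℂ}
    {x y : Ω → ℝ} (hX : HasStochIntegral P F Z φ (fun ω => (x ω : ℂ)))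
    (hY : HasStochIntegral P F Z ψ (fun ω => (y ω : ℂ))) :
    ((∫ ω, x ω * y ω ∂P : ℝ) : ℂ) = ∫ l, φ l * (starRingEnd ℂ) (ψ l) ∂F := by
  rw [← hX.integral_mul_conj hZ hY, ← integral_complex_ofReal]
  simp

end StochIntegral

/-! ### Random variables in the Gaussian space -/

/-- The square integrable random variable `y` belongs to the Gaussian space of `Z`. -/
def InGaussianSpace {Ω : Type*} [MeasurableSpace Ω] (P : Measure Ω) (F : Measure ℝ)
    (Z : Set ℝ → Ω → ℂ) (y : Ω → ℝ) : Prop :=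
  ∃ hy : MemLp y 2 P, hy.toLp y ∈ gaussianSpace P F Z

namespace InGaussianSpace

variable {Ω : Type*} [MeasurableSpace Ω] {P : Measure Ω} {F : Measure ℝ} {Z : Set ℝ → Ω → ℂ}
  {y : Ω → ℝ}

lemma memLp (hy : InGaussianSpace P F Z y) : MemLp y 2 P := hy.1

lemma congr (hy : InGaussianSpace P F Z y) {y' : Ω → ℝ} (h : y =ᵐ[P] y') :
    InGaussianSpace P F Z y' := by
  refine ⟨hy.1.ae_eq h, ?_⟩
  rw [← MemLp.toLp_congr hy.1 (hy.1.ae_eq h) h]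
  exact hy.2

lemma const_mul (hy : InGaussianSpace P F Z y) (a : ℝ) :
    InGaussianSpace P F Z (fun ω => a * y ω) :=
  ⟨hy.1.const_mul a, Submodule.smul_mem _ a hy.2⟩

lemma sum {ι : Type*} {s : Finset ι} {y : ι → Ω → ℝ}
    (hy : ∀ i ∈ s, InGaussianSpace P F Z (y i)) :
    InGaussianSpace P F Z (fun ω => ∑ i ∈ s, y i ω) := by
  classical
  induction s using Finset.induction_on with
  | empty =>
    simp only [Finset.sum_empty]
    exact ⟨MemLp.zero', Submodule.zero_mem _⟩
  | insert i s hi ih =>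
    obtain ⟨h1, h1'⟩ := hy i (by simp)
    obtain ⟨h2, h2'⟩ := ih fun j hj => hy j (by simp [hj])
    simp only [Finset.sum_insert hi]
    exact ⟨h1.add h2, Submodule.add_mem _ h1' h2'⟩

variable [IsProbabilityMeasure P]

lemma map_eq_gaussianReal (hZ : IsGaussianRandomMeasure P F Z) (hy : InGaussianSpace P F Z y) :
    P.map y = gaussianReal 0 (∫ ω, y ω ^ 2 ∂P).toNNReal := by
  have h := hZ.map_eq_gaussianReal hy.2
  rw [norm_sq_Lp_two_eq, Measure.map_congr hy.1.coeFn_toLp] at h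
  rw [h]
  congr 2
  refine integral_congr_ae ?_
  filter_upwards [hy.1.coeFn_toLp] with ω hω
  rw [hω]

lemma integral_eq_zero (hZ : IsGaussianRandomMeasure P F Z) (hy : InGaussianSpace P F Z y) :
    ∫ ω, y ω ∂P = 0 := by
  have h := integral_map hy.1.aemeasurable (f := fun x : ℝ => x) (by fun_prop)
  rw [← h, hy.map_eq_gaussianReal hZ, integral_id_gaussianReal]

lemma covariance_eq (hZ : IsGaussianRandomMeasure P F Z) (hy : InGaussianSpace P F Z y)
    {y' : Ω → ℝ} (hy' : InGaussianSpace P F Z y') : cov[y, y'; P] = ∫ ω, y ω * y' ω ∂P := by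
  rw [covariance, hy.integral_eq_zero hZ, hy'.integral_eq_zero hZ]
  simp

lemma integral_exp_I_mul (hZ : IsGaussianRandomMeasure P F Z) (hy : InGaussianSpace P F Z y) :
    ∫ ω, Complex.exp (y ω * Complex.I) ∂P =
      Complex.exp (-((∫ ω, y ω ^ 2 ∂P : ℝ) : ℂ) / 2) := by
  have h := charFun_gaussianReal (μ := 0) (v := (∫ ω, y ω ^ 2 ∂P).toNNReal) 1
  rw [← hy.map_eq_gaussianReal hZ, charFun_apply_real,
    integral_map hy.1.aemeasurable (by fun_prop),
    Real.coe_toNNReal _ (integral_nonneg fun _ => sq_nonneg _)] at h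
  convert! h using 2
  · ext ω; simp
  · simp; ring

/-- Finitely many elements of the Gaussian space are jointly Gaussian. -/
lemma hasGaussianLaw_pi (hZ : IsGaussianRandomMeasure P F Z) {ι : Type*} [Fintype ι]
    {y : ι → Ω → ℝ} (hy : ∀ i, InGaussianSpace P F Z (y i)) :
    HasGaussianLaw (fun ω i => y i ω) P := by
  classical
  constructor
  have hm : AEMeasurable (fun ω i => y i ω) P :=
    aemeasurable_pi_lambda _ fun i => (hy i).1.aemeasurable
  -- A linear functional of the vector is a linear combination of its coordinates, hence again in
  -- the Gaussian space and Gaussian.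
  refine isGaussian_of_map_eq_gaussianReal fun L =>
    ⟨0, (∫ ω, (∑ i, L (Pi.single i 1) * y i ω) ^ 2 ∂P).toNNReal, ?_⟩
  rw [← (InGaussianSpace.sum (s := Finset.univ) fun i _ =>
    (hy i).const_mul (L (Pi.single i 1))).map_eq_gaussianReal hZ,
    AEMeasurable.map_map_of_aemeasurable (by fun_prop) hm]
  congr 1
  ext ω
  simp only [Function.comp]
  conv_lhs => rw [← Finset.univ_sum_single (fun i => y i ω), map_sum]
  refine Finset.sum_congr rfl fun i _ => ?_
  have : (Pi.single i (y i ω) : ι → ℝ) = (y i ω) • Pi.single i 1 := by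
    rw [← Pi.single_smul]; simp
  rw [this, map_smul, smul_eq_mul, mul_comm]

/-- The joint characteristic function depends only on the matrix of second moments. The vector is
moved to Euclidean space because `charFun` needs an inner product. -/
lemma charFun_map_toLp (hZ : IsGaussianRandomMeasure P F Z) {ι : Type*} [Fintype ι]
    {y : ι → Ω → ℝ} (hy : ∀ i, InGaussianSpace P F Z (y i)) (a : EuclideanSpace ℝ ι) :
    charFun (P.map (fun ω => WithLp.toLp 2 (fun i => y i ω))) a =
      Complex.exp (-((∑ i, ∑ j, a i * a j * ∫ ω, y i ω * y j ω ∂P : ℝ) : ℂ) / 2) := by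
  have hm : AEMeasurable (fun ω i => y i ω) P :=
    aemeasurable_pi_lambda _ fun i => (hy i).1.aemeasurable
  have hm' : AEMeasurable (fun ω => WithLp.toLp 2 (fun i => y i ω)) P :=
    (by fun_prop : Measurable (WithLp.toLp 2 : (ι → ℝ) → EuclideanSpace ℝ ι)).comp_aemeasurable hm
  rw [charFun_apply, integral_map hm' (by fun_prop)]
  have h := (InGaussianSpace.sum (s := Finset.univ) fun i _ =>
    (hy i).const_mul (a i)).integral_exp_I_mul hZ
  have hsq : ∫ ω, (∑ i, a i * y i ω) ^ 2 ∂P = ∑ i, ∑ j, a i * a j * ∫ ω, y i ω * y j ω ∂P := by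
    have hint : ∀ i j, Integrable (fun ω => a i * y i ω * (a j * y j ω)) P := fun i j =>
      ((hy i).1.const_mul _).integrable_mul ((hy j).1.const_mul _)
    simp_rw [pow_two, Finset.sum_mul_sum]
    rw [integral_finsetSum _ fun i _ => integrable_finsetSum _ fun j _ => hint i j]
    refine Finset.sum_congr rfl fun i _ => ?_
    rw [integral_finsetSum _ fun j _ => hint i j]
    refine Finset.sum_congr rfl fun j _ => ?_
    rw [← integral_const_mul]
    congr 1
    ext ω
    ring
  rw [hsq] at h
  rw [← h]
  simp [PiLp.inner_apply]

end InGaussianSpace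

lemma HasStochIntegral.inGaussianSpace {Ω : Type*} [MeasurableSpace Ω] {P : Measure Ω}
    {F : Measure ℝ} {Z : Set ℝ → Ω → ℂ} (hZ : IsGaussianRandomMeasure P F Z) {φ : ℝ → ℂ}
    {y : Ω → ℝ} (h : HasStochIntegral P F Z φ (fun ω => (y ω : ℂ))) : InGaussianSpace P F Z y :=
  ⟨_, h.toLp_mem_gaussianSpace hZ⟩

/-- Centred Gaussian vectors converge in distribution if their covariances do. -/
lemma tendstoInDistribution_of_inGaussianSpace {Ω Ω' : Type*} [MeasurableSpace Ω]
    [MeasurableSpace Ω'] {P : Measure Ω} [IsProbabilityMeasure P] {P' : Measure Ω'}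
    [IsProbabilityMeasure P'] {F F' : Measure ℝ} {Z : Set ℝ → Ω → ℂ} {W : Set ℝ → Ω' → ℂ}
    (hZ : IsGaussianRandomMeasure P F Z) (hW : IsGaussianRandomMeasure P' F' W)
    {α ι : Type*} [Fintype ι] {l : Filter α} [l.IsCountablyGenerated]
    {X : α → ι → Ω → ℝ} {V : ι → Ω' → ℝ}
    (hX : ∀ a i, InGaussianSpace P F Z (X a i)) (hV : ∀ i, InGaussianSpace P' F' W (V i))
    (h : ∀ i j, Tendsto (fun a => ∫ ω, X a i ω * X a j ω ∂P) l (𝓝 (∫ ω, V i ω * V j ω ∂P'))) :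
    TendstoInDistribution (fun a ω i => X a i ω) l (fun ω i => V i ω) (fun _ => P) P' := by
  have hmX : ∀ a, AEMeasurable (fun ω i => X a i ω) P := fun a =>
    aemeasurable_pi_lambda _ fun i => (hX a i).1.aemeasurable
  have hmV : AEMeasurable (fun ω i => V i ω) P' :=
    aemeasurable_pi_lambda _ fun i => (hV i).1.aemeasurable
  have hmeas : Measurable (WithLp.toLp 2 : (ι → ℝ) → EuclideanSpace ℝ ι) := by fun_prop
  have hE : TendstoInDistribution (fun a ω => WithLp.toLp 2 (fun i => X a i ω)) l
      (fun ω => WithLp.toLp 2 (fun i => V i ω)) (fun _ => P) P' := by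
    refine ⟨fun a => hmeas.comp_aemeasurable (hmX a), hmeas.comp_aemeasurable hmV, ?_⟩
    -- The filter is countably generated, so sequences suffice, and for these Lévy's continuity
    -- theorem applies.
    refine tendsto_of_seq_tendsto fun x hx => ?_
    refine ProbabilityMeasure.tendsto_of_tendsto_charFun fun t => ?_
    simp only [Function.comp, ProbabilityMeasure.coe_mk]
    rw [InGaussianSpace.charFun_map_toLp hW hV]
    simp_rw [InGaussianSpace.charFun_map_toLp hZ (hX _)]
    refine (Complex.continuous_exp.tendsto _).comp (Tendsto.div_const (Tendsto.neg ?_) _)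
    refine (Complex.continuous_ofReal.tendsto _).comp ?_
    exact tendsto_finsetSum _ fun i _ => tendsto_finsetSum _ fun j _ =>
      ((h i j).comp hx).const_mul _
  exact hE.continuous_comp (g := WithLp.ofLp) (by fun_prop)

/-! ### Averages of a random field -/

section Average

variable {Ω : Type*} [MeasurableSpace Ω] {P : Measure Ω} [IsProbabilityMeasure P]
  {ν : Measure ℝ} [IsProbabilityMeasure ν] {ξ : ℝ → Ω → ℝ} {C : ℝ}

lemma memLp_two_uncurry (hm : AEStronglyMeasurable (Function.uncurry ξ) (ν.prod P))
    (hξ : ∀ x, MemLp (ξ x) 2 P) (hC : ∀ x, ∫ ω, ξ x ω ^ 2 ∂P ≤ C) :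
    MemLp (Function.uncurry ξ) 2 (ν.prod P) := by
  rw [memLp_two_iff_integrable_sq hm, integrable_prod_iff (by fun_prop)]
  refine ⟨ae_of_all _ fun x => (hξ x).integrable_sq, ?_⟩
  refine Integrable.of_bound (C := C) ?_ (ae_of_all _ fun x => ?_)
  · exact (hm.pow 2).norm.integral_prod_right'
  · simp only [Function.uncurry, norm_pow, Real.norm_eq_abs, sq_abs]
    rw [abs_of_nonneg (integral_nonneg fun _ => sq_nonneg _)]
    exact hC x

lemma memLp_two_integral (hm : AEStronglyMeasurable (Function.uncurry ξ) (ν.prod P))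
    (hξ : ∀ x, MemLp (ξ x) 2 P) (hC : ∀ x, ∫ ω, ξ x ω ^ 2 ∂P ≤ C) :
    MemLp (fun ω => ∫ x, ξ x ω ∂ν) 2 P := by
  have h2 := memLp_two_uncurry hm hξ hC
  have hmeas : AEStronglyMeasurable (fun ω => ∫ x, ξ x ω ∂ν) P :=
    (hm.prod_swap).integral_prod_right'
  rw [memLp_two_iff_integrable_sq hmeas]
  have hsq := h2.integrable_sq.swap
  refine Integrable.mono' hsq.integral_prod_left (hmeas.pow 2) ?_
  filter_upwards [hm.prod_swap.prodMk_left, hsq.prod_right_ae] with ω h3 h4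
  have h5 : MemLp (fun x => ξ x ω) 2 ν := (memLp_two_iff_integrable_sq h3).2 h4
  -- Jensen's inequality (∫ ξ dν)² ≤ ∫ ξ² dν, in the form of nonnegativity of the variance under ν.
  have h6 := variance_eq_sub h5
  have h7 := variance_nonneg (fun x => ξ x ω) ν
  rw [Real.norm_eq_abs, abs_of_nonneg (sq_nonneg _)]
  simp only [Pi.pow_apply] at h6
  simp only [Function.comp, Prod.swap, Function.uncurry]
  linarith

lemma integral_integral_mul (hm : AEStronglyMeasurable (Function.uncurry ξ) (ν.prod P))
    (hξ : ∀ x, MemLp (ξ x) 2 P) (hC : ∀ x, ∫ ω, ξ x ω ^ 2 ∂P ≤ C) {g : Ω → ℝ}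
    (hg : MemLp g 2 P) :
    ∫ ω, (∫ x, ξ x ω ∂ν) * g ω ∂P = ∫ x, ∫ ω, ξ x ω * g ω ∂P ∂ν := by
  simp_rw [← integral_mul_const]
  refine (integral_integral_swap (f := fun x ω => ξ x ω * g ω) ?_).symm
  exact (memLp_two_uncurry hm hξ hC).integrable_mul (hg.comp_snd ν)

/-- The average of elements of the Gaussian space is in the Gaussian space. -/
lemma InGaussianSpace.integral {F : Measure ℝ} {Z : Set ℝ → Ω → ℂ}
    (hm : AEStronglyMeasurable (Function.uncurry ξ) (ν.prod P))
    (hξ : ∀ x, InGaussianSpace P F Z (ξ x)) (hC : ∀ x, ∫ ω, ξ x ω ^ 2 ∂P ≤ C) :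
    InGaussianSpace P F Z (fun ω => ∫ x, ξ x ω ∂ν) := by
  have hY := memLp_two_integral hm (fun x => (hξ x).memLp) hC
  refine ⟨hY, ?_⟩
  -- The closed span is its own double orthogonal complement. Testing against g orthogonal to it,
  -- Fubini moves the average outside, where each ξ x is already orthogonal to g.
  rw [gaussianSpace, ← Submodule.orthogonal_orthogonal_eq_closure, Submodule.mem_orthogonal]
  intro g hg
  have hinner : ∀ {y : Ω → ℝ} (hy : MemLp y 2 P),
      inner ℝ g (hy.toLp y) = ∫ ω, y ω * g ω ∂P := by
    intro y hy
    rw [L2.inner_def]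
    refine integral_congr_ae ?_
    filter_upwards [hy.coeFn_toLp] with ω hω
    rw [hω]
    simp
  rw [hinner, integral_integral_mul hm (fun x => (hξ x).memLp) hC (Lp.memLp g)]
  refine integral_eq_zero_of_ae (ae_of_all _ fun x => ?_)
  obtain ⟨h1, h2⟩ := hξ x
  rw [gaussianSpace, ← Submodule.orthogonal_orthogonal_eq_closure, Submodule.mem_orthogonal] at h2
  exact (hinner h1).symm.trans (h2 g hg)

lemma integral_integral_mul_integral
    {ν' : Measure ℝ} [IsProbabilityMeasure ν'] {ξ' : ℝ → Ω → ℝ} {C' : ℝ}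
    (hm : AEStronglyMeasurable (Function.uncurry ξ) (ν.prod P))
    (hξ : ∀ x, MemLp (ξ x) 2 P) (hC : ∀ x, ∫ ω, ξ x ω ^ 2 ∂P ≤ C)
    (hm' : AEStronglyMeasurable (Function.uncurry ξ') (ν'.prod P))
    (hξ' : ∀ x, MemLp (ξ' x) 2 P) (hC' : ∀ x, ∫ ω, ξ' x ω ^ 2 ∂P ≤ C') :
    ∫ ω, (∫ x, ξ x ω ∂ν) * (∫ x, ξ' x ω ∂ν') ∂P =
      ∫ x, ∫ x', ∫ ω, ξ x ω * ξ' x' ω ∂P ∂ν' ∂ν := by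
  rw [integral_integral_mul hm hξ hC (memLp_two_integral hm' hξ' hC')]
  congr 1
  ext x
  simp_rw [mul_comm (ξ x _)]
  exact integral_integral_mul hm' hξ' hC' (hξ x)

end Average

/-- The kernel is √π times the density of N(x, 1/2), so averaging is integration against a
probability measure. -/
lemma integral_exp_neg_sub_sq_mul {f : ℝ → ℝ} (x : ℝ) :
    ∫ y, Real.exp (-(y - x) ^ 2) * f y = √Real.pi * ∫ y, f y ∂(gaussianReal x (1 / 2)) := by
  rw [integral_gaussianReal_eq_integral_smul (by norm_num), ← integral_const_mul]
  congr 1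
  ext y
  have h : √Real.pi ≠ 0 := (Real.sqrt_pos.2 Real.pi_pos).ne'
  simp only [gaussianPDFReal, smul_eq_mul, NNReal.coe_div, NNReal.coe_one, NNReal.coe_ofNat]
  rw [show 2 * Real.pi * (1 / 2) = Real.pi by ring, show (2 : ℝ) * (1 / 2) = 1 by norm_num]
  field_simp

lemma integrable_gaussianReal_half_iff {f : ℝ → ℝ} (x : ℝ) :
    Integrable f (gaussianReal x (1 / 2)) ↔
      Integrable (fun y => Real.exp (-(y - x) ^ 2) * f y) := by
  rw [gaussianReal_of_var_ne_zero _ (by norm_num),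
    integrable_withDensity_iff_integrable_smul' (measurable_gaussianPDF _ _) (by simp [gaussianPDF])]
  have h : √Real.pi ≠ 0 := (Real.sqrt_pos.2 Real.pi_pos).ne'
  rw [← integrable_const_mul_iff (c := √Real.pi) (IsUnit.mk0 _ h)]
  refine iff_of_eq (congrArg (fun g => Integrable g volume) ?_)
  ext y
  rw [toReal_gaussianPDF]
  simp only [gaussianPDFReal, smul_eq_mul, NNReal.coe_div, NNReal.coe_one, NNReal.coe_ofNat]
  rw [show 2 * Real.pi * (1 / 2) = Real.pi by ring, show (2 : ℝ) * (1 / 2) = 1 by norm_num]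
  field_simp

/-! ### The covariance of the rescaled averages -/

/-- The integrand of the spectral representation of the covariance of kernel averages. -/
def averageKernel (μ : ℝ) (m : ℕ) (t x t' x' l : ℝ) : ℂ :=
  Complex.exp (Complex.I * ((phase μ m t x l - phase μ m t' x' l : ℝ) : ℂ)) *
    (Real.exp (-l ^ 2 / 2) : ℝ)

lemma continuous_phase (μ : ℝ) (m : ℕ) (t : ℝ) :
    Continuous (fun p : ℝ × ℝ => phase μ m t p.1 p.2) := by
  unfold phase
  fun_prop

lemma norm_cexp_I_mul_ofReal (x : ℝ) : ‖Complex.exp (Complex.I * (x : ℂ))‖ = 1 := by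
  rw [mul_comm, Complex.norm_exp_ofReal_mul_I]

lemma cexp_I_mul_conj (x y : ℝ) :
    Complex.exp (Complex.I * (x : ℂ)) * (starRingEnd ℂ) (Complex.exp (Complex.I * (y : ℂ))) =
      Complex.exp (Complex.I * ((x - y : ℝ) : ℂ)) := by
  rw [← Complex.exp_conj, ← Complex.exp_add]
  congr 1
  simp
  ring

/-- Because √(ε^m) = (√ε)^m, both scalings turn the phase into one in the variable l/√ε. The
Gaussian average is then the characteristic function of N(x, 1/2) at l/√ε. -/
lemma integral_gaussianReal_cexp_phase (μ : ℝ) (m : ℕ) {ε : ℝ} (hε : 0 < ε) (t x l : ℝ) :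
    ∫ y, Complex.exp (Complex.I * (phase μ m (t / √(ε ^ m)) (y / √ε) l : ℂ))
      ∂(gaussianReal x (1 / 2)) =
    Complex.exp (Complex.I * (phase μ m t x (l / √ε) : ℂ)) *
      (Real.exp (-(l / √ε) ^ 2 / 4) : ℝ) := by
  have hs : √(ε ^ m) = √ε ^ m := by
    rw [Real.sqrt_eq_iff_mul_self_eq (by positivity) (by positivity), ← mul_pow,
      Real.mul_self_sqrt hε.le]
  have h := charFun_gaussianReal (μ := x) (v := 1 / 2) (l / √ε)
  rw [charFun_apply_real] at h
  have h2 : ∀ y : ℝ, Complex.exp (Complex.I * (phase μ m (t / √(ε ^ m)) (y / √ε) l : ℂ)) =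
      Complex.exp (Complex.I * ((phase μ m t x (l / √ε) - l / √ε * x : ℝ) : ℂ)) *
        Complex.exp (((l / √ε : ℝ) : ℂ) * y * Complex.I) := by
    intro y
    rw [← Complex.exp_add]
    congr 1
    rw [hs, phase, phase, div_pow]
    push_cast
    ring
  simp_rw [h2]
  rw [integral_const_mul, h, Complex.ofReal_exp, ← Complex.exp_add, ← Complex.exp_add]
  congr 1
  simp
  ring

lemma integral_integral_swap_of_bounded {α β : Type*} [MeasurableSpace α] [MeasurableSpace β]
    {ρ : Measure α} {τ : Measure β} [IsFiniteMeasure ρ] [IsFiniteMeasure τ] {f : α → β → ℂ}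
    (hf : Measurable (Function.uncurry f)) (h : ∀ a b, ‖f a b‖ ≤ 1) :
    ∫ a, ∫ b, f a b ∂τ ∂ρ = ∫ b, ∫ a, f a b ∂ρ ∂τ :=
  integral_integral_swap
    (Integrable.of_bound hf.aestronglyMeasurable 1 (ae_of_all _ fun p => h p.1 p.2))

/-- Fubini for bounded integrands: each of the two averages contributes a factor exp(-(l/√ε)²/4),
and together they give the Gaussian factor of `averageKernel`. -/
lemma integral_integral_integral_cexp_phase (F : Measure ℝ) [IsFiniteMeasure F] (μ : ℝ) (m : ℕ)
    {ε : ℝ} (hε : 0 < ε) (t x t' x' : ℝ) :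
    ∫ y, ∫ y', ∫ l, Complex.exp (Complex.I * (phase μ m (t / √(ε ^ m)) (y / √ε) l : ℂ)) *
      (starRingEnd ℂ) (Complex.exp (Complex.I * (phase μ m (t' / √(ε ^ m)) (y' / √ε) l : ℂ))) ∂F
      ∂(gaussianReal x' (1 / 2)) ∂(gaussianReal x (1 / 2)) =
    ∫ l, averageKernel μ m t x t' x' (l / √ε) ∂F := by
  have hph : ∀ s, Measurable (fun p : ℝ × ℝ => phase μ m s (p.1 / √ε) p.2) := fun s =>
    ((continuous_phase μ m s).comp (by fun_prop :
      Continuous fun p : ℝ × ℝ => (p.1 / √ε, p.2))).measurable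
  have hb : ∀ a b : ℝ, ‖Complex.exp (Complex.I * (a : ℂ)) *
      (starRingEnd ℂ) (Complex.exp (Complex.I * (b : ℂ)))‖ ≤ 1 := by
    intro a b
    rw [cexp_I_mul_conj, norm_cexp_I_mul_ofReal]
  have h1 : ∀ y, ∫ y', ∫ l, Complex.exp (Complex.I * (phase μ m (t / √(ε ^ m)) (y / √ε) l : ℂ)) *
      (starRingEnd ℂ) (Complex.exp (Complex.I * (phase μ m (t' / √(ε ^ m)) (y' / √ε) l : ℂ))) ∂F
      ∂(gaussianReal x' (1 / 2)) =
      ∫ l, Complex.exp (Complex.I * (phase μ m (t / √(ε ^ m)) (y / √ε) l : ℂ)) *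
        (starRingEnd ℂ) (Complex.exp (Complex.I * (phase μ m t' x' (l / √ε) : ℂ)) *
      (Real.exp (-(l / √ε) ^ 2 / 4) : ℝ)) ∂F := by
    intro y
    rw [integral_integral_swap_of_bounded _ (fun y' l => hb _ _)]
    · congr 1
      ext l
      rw [integral_const_mul, integral_conj, integral_gaussianReal_cexp_phase μ m hε]
    · have h2 := hph (t' / √(ε ^ m))
      have h3 : Measurable (fun p : ℝ × ℝ => phase μ m (t / √(ε ^ m)) (y / √ε) p.2) :=
        (hph (t / √(ε ^ m))).comp (by fun_prop : Measurable fun p : ℝ × ℝ => (y, p.2))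
      simp only [Function.uncurry_def]
      refine Measurable.mul (by fun_prop) (Complex.continuous_conj.measurable.comp (by fun_prop))
  simp_rw [h1]
  rw [integral_integral_swap_of_bounded]
  · congr 1
    ext l
    rw [integral_mul_const, integral_gaussianReal_cexp_phase μ m hε, averageKernel,
      ← cexp_I_mul_conj, map_mul, Complex.conj_ofReal]
    have : Real.exp (-(l / √ε) ^ 2 / 2) =
        Real.exp (-(l / √ε) ^ 2 / 4) * Real.exp (-(l / √ε) ^ 2 / 4) := by
      rw [← Real.exp_add]; ring_nf
    rw [this]
    push_cast
    ring
  · have h2 := hph (t / √(ε ^ m))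
    have h3 : Measurable (fun p : ℝ × ℝ => phase μ m t' x' (p.2 / √ε)) :=
      ((continuous_phase μ m t').comp (by fun_prop :
        Continuous fun p : ℝ × ℝ => (x', p.2 / √ε))).measurable
    simp only [Function.uncurry_def]
    refine Measurable.mul (by fun_prop) (Complex.continuous_conj.measurable.comp ?_)
    fun_prop
  · intro y l
    rw [map_mul, ← mul_assoc, norm_mul, cexp_I_mul_conj, norm_cexp_I_mul_ofReal, one_mul,
      Complex.conj_ofReal, Complex.norm_real, Real.norm_eq_abs, Real.abs_exp, Real.exp_le_one_iff]
    have := sq_nonneg (l / √ε)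
    linarith

namespace IsSolutionField

variable {Ω : Type*} [MeasurableSpace Ω] {P : Measure Ω} [IsProbabilityMeasure P]
  {F : Measure ℝ} {Z : Set ℝ → Ω → ℂ} {c μ : ℝ} {m : ℕ} {mean : ℝ → ℝ → ℝ}
  {u : ℝ → ℝ → Ω → ℝ}

omit [IsProbabilityMeasure P] in
lemma inGaussianSpace (hZ : IsGaussianRandomMeasure P F Z)
    (hu : IsSolutionField P F Z c μ m mean u) {t : ℝ} (ht : 0 < t) (x : ℝ) :
    InGaussianSpace P F Z (fun ω => u t x ω - mean t x) :=
  (hu.spectral t ht x).inGaussianSpace hZ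

omit [IsProbabilityMeasure P] in
lemma integral_mul_eq (hZ : IsGaussianRandomMeasure P F Z)
    (hu : IsSolutionField P F Z c μ m mean u) {t t' : ℝ} (ht : 0 < t) (ht' : 0 < t') (x x' : ℝ) :
    ((∫ ω, (u t x ω - mean t x) * (u t' x' ω - mean t' x') ∂P : ℝ) : ℂ) =
      c ^ 2 * ∫ l, Complex.exp (Complex.I * (phase μ m t x l : ℂ)) *
        (starRingEnd ℂ) (Complex.exp (Complex.I * (phase μ m t' x' l : ℂ))) ∂F := by
  rw [(hu.spectral t ht x).integral_mul_eq hZ (hu.spectral t' ht' x'), ← integral_const_mul]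
  congr 1
  ext l
  rw [map_mul, Complex.conj_ofReal]
  ring

-- The exponential has modulus one, so the variance is the same at every t and x; this is the
-- uniform bound that the averaging lemmas require.
omit [IsProbabilityMeasure P] in
lemma integral_sq_eq (hZ : IsGaussianRandomMeasure P F Z)
    (hu : IsSolutionField P F Z c μ m mean u) {t : ℝ} (ht : 0 < t) (x : ℝ) :
    ∫ ω, (u t x ω - mean t x) ^ 2 ∂P = c ^ 2 * F.real Set.univ := by
  have h := hu.integral_mul_eq hZ ht ht x x
  simp_rw [cexp_I_mul_conj] at h
  simp only [sub_self, Complex.ofReal_zero, mul_zero, Complex.exp_zero] at h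
  rw [integral_const] at h
  simp_rw [pow_two (u t x _ - mean t x)]
  rw [Complex.real_smul, mul_one] at h
  exact_mod_cast h

/-- The mean field is the expectation of the jointly measurable u, so its measurability follows and
is not an assumption. -/
lemma measurable_mean (hZ : IsGaussianRandomMeasure P F Z)
    (hu : IsSolutionField P F Z c μ m mean u) {t : ℝ} (ht : 0 < t) : Measurable (mean t) := by
  have h : mean t = fun x => ∫ ω, u t x ω ∂P := by
    ext x
    have hx := hu.inGaussianSpace hZ ht x
    have h1 : ∫ ω, ((u t x ω - mean t x) + mean t x) ∂P = mean t x := by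
      rw [integral_add (hx.memLp.integrable (by norm_num)) (integrable_const _),
        hx.integral_eq_zero hZ]
      simp
    simpa using h1.symm
  rw [h]
  exact ((hu.measurable t ht).stronglyMeasurable.integral_prod_right).measurable

/-- The average of the centred field with respect to a Gaussian law. -/
def centredAverage (m : ℕ) (mean : ℝ → ℝ → ℝ) (u : ℝ → ℝ → Ω → ℝ) (ε t x : ℝ) (ω : Ω) : ℝ :=
  ∫ y, (u (t / √(ε ^ m)) (y / √ε) ω - mean (t / √(ε ^ m)) (y / √ε)) ∂(gaussianReal x (1 / 2))

lemma measurable_uncurry_sub (hZ : IsGaussianRandomMeasure P F Z)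
    (hu : IsSolutionField P F Z c μ m mean u) {t : ℝ} (ht : 0 < t) (ε : ℝ) :
    Measurable (Function.uncurry fun y ω => u t (y / √ε) ω - mean t (y / √ε)) := by
  have h1 := (hu.measurable t ht).comp
    (by fun_prop : Measurable fun p : ℝ × Ω => (p.1 / √ε, p.2))
  have h2 := (hu.measurable_mean hZ ht).comp (by fun_prop : Measurable fun p : ℝ × Ω => p.1 / √ε)
  exact h1.sub h2

lemma inGaussianSpace_centredAverage (hZ : IsGaussianRandomMeasure P F Z)
    (hu : IsSolutionField P F Z c μ m mean u) {ε t : ℝ} (hε : 0 < ε) (ht : 0 < t) (x : ℝ) :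
    InGaussianSpace P F Z (centredAverage m mean u ε t x) := by
  have hτ : 0 < t / √(ε ^ m) := by positivity
  exact InGaussianSpace.integral (hu.measurable_uncurry_sub hZ hτ ε).aestronglyMeasurable
    (fun y => hu.inGaussianSpace hZ hτ _) (fun y => (hu.integral_sq_eq hZ hτ _).le)

lemma integral_centredAverage_mul [IsFiniteMeasure F] (hZ : IsGaussianRandomMeasure P F Z)
    (hu : IsSolutionField P F Z c μ m mean u) {ε t t' : ℝ} (hε : 0 < ε) (ht : 0 < t)
    (ht' : 0 < t') (x x' : ℝ) :
    ((∫ ω, centredAverage m mean u ε t x ω * centredAverage m mean u ε t' x' ω ∂P : ℝ) : ℂ) =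
      c ^ 2 * ∫ l, averageKernel μ m t x t' x' (l / √ε) ∂F := by
  have hτ : 0 < t / √(ε ^ m) := by positivity
  have hτ' : 0 < t' / √(ε ^ m) := by positivity
  unfold centredAverage
  rw [integral_integral_mul_integral
    (hu.measurable_uncurry_sub hZ hτ ε).aestronglyMeasurable
    (fun y => (hu.inGaussianSpace hZ hτ _).memLp) (fun y => (hu.integral_sq_eq hZ hτ _).le)
    (hu.measurable_uncurry_sub hZ hτ' ε).aestronglyMeasurable
    (fun y => (hu.inGaussianSpace hZ hτ' _).memLp) (fun y => (hu.integral_sq_eq hZ hτ' _).le),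
    ← integral_integral_integral_cexp_phase F μ m hε, ← integral_complex_ofReal,
    ← integral_const_mul]
  congr 1
  ext y
  rw [← integral_complex_ofReal, ← integral_const_mul]
  congr 1
  ext y'
  exact hu.integral_mul_eq hZ hτ hτ' _ _

lemma rescaledAverage_ae_eq (hZ : IsGaussianRandomMeasure P F Z)
    (hu : IsSolutionField P F Z c μ m mean u)
    (hmean_int : ∀ t, 0 < t → ∀ ε, 0 < ε → ∀ x,
      Integrable (fun x₁ : ℝ => Real.exp (-(x₁ - x) ^ 2) * mean t (x₁ / √ε)))
    (κ₀ : ℝ) {ε t : ℝ} (hε : 0 < ε) (ht : 0 < t) (x : ℝ) :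
    (fun ω => ε ^ (-κ₀ / 4) * √Real.pi * centredAverage m mean u ε t x ω) =ᵐ[P]
      rescaledAverage P κ₀ m u ε t x := by
  have hτ : 0 < t / √(ε ^ m) := by positivity
  have hmi := (integrable_gaussianReal_half_iff x).2 (hmean_int _ hτ ε hε x)
  -- Joint square integrability: by Fubini the centred field is integrable in y for almost every ω,
  -- so the average of u splits into its centred part and the average of the mean. The latter
  -- cancels after centring.
  have hint := (memLp_two_uncurry (ν := gaussianReal x (1 / 2))
    (hu.measurable_uncurry_sub hZ hτ ε).aestronglyMeasurable
    (fun y => (hu.inGaussianSpace hZ hτ _).memLp)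
    (fun y => (hu.integral_sq_eq hZ hτ _).le)).integrable (by norm_num)
  have hk : ∀ᵐ ω ∂P, kernelAverage m u ε t x ω = √Real.pi * (centredAverage m mean u ε t x ω +
      ∫ y, mean (t / √(ε ^ m)) (y / √ε) ∂(gaussianReal x (1 / 2))) := by
    filter_upwards [hint.swap.prod_right_ae] with ω hω
    rw [kernelAverage, integral_exp_neg_sub_sq_mul, centredAverage, ← integral_add _ hmi]
    · simp
    · exact hω
  have hG := hu.inGaussianSpace_centredAverage hZ hε ht x
  have hE : ∫ ω, kernelAverage m u ε t x ω ∂P =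
      √Real.pi * ∫ y, mean (t / √(ε ^ m)) (y / √ε) ∂(gaussianReal x (1 / 2)) := by
    rw [integral_congr_ae hk, integral_const_mul,
      integral_add (hG.memLp.integrable (by norm_num)) (integrable_const _),
      hG.integral_eq_zero hZ]
    simp
  filter_upwards [hk] with ω hω
  rw [rescaledAverage, hω, hE]
  ring

lemma inGaussianSpace_rescaledAverage (hZ : IsGaussianRandomMeasure P F Z)
    (hu : IsSolutionField P F Z c μ m mean u)
    (hmean_int : ∀ t, 0 < t → ∀ ε, 0 < ε → ∀ x,
      Integrable (fun x₁ : ℝ => Real.exp (-(x₁ - x) ^ 2) * mean t (x₁ / √ε)))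
    (κ₀ : ℝ) {ε t : ℝ} (hε : 0 < ε) (ht : 0 < t) (x : ℝ) :
    InGaussianSpace P F Z (rescaledAverage P κ₀ m u ε t x) :=
  ((hu.inGaussianSpace_centredAverage hZ hε ht x).const_mul _).congr
    (hu.rescaledAverage_ae_eq hZ hmean_int κ₀ hε ht x)

lemma integral_rescaledAverage_mul [IsFiniteMeasure F] (hZ : IsGaussianRandomMeasure P F Z)
    (hu : IsSolutionField P F Z c μ m mean u)
    (hmean_int : ∀ t, 0 < t → ∀ ε, 0 < ε → ∀ x,
      Integrable (fun x₁ : ℝ => Real.exp (-(x₁ - x) ^ 2) * mean t (x₁ / √ε)))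
    (κ₀ : ℝ) {ε t t' : ℝ} (hε : 0 < ε) (ht : 0 < t) (ht' : 0 < t') (x x' : ℝ) :
    ((∫ ω, rescaledAverage P κ₀ m u ε t x ω * rescaledAverage P κ₀ m u ε t' x' ω ∂P : ℝ) : ℂ) =
      (c ^ 2 * Real.pi : ℝ) * (((√ε) ^ (-κ₀) : ℝ) *
        ∫ l, averageKernel μ m t x t' x' (l / √ε) ∂F) := by
  have h : ∫ ω, rescaledAverage P κ₀ m u ε t x ω * rescaledAverage P κ₀ m u ε t' x' ω ∂P =
      (√ε) ^ (-κ₀) * Real.pi *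
        ∫ ω, centredAverage m mean u ε t x ω * centredAverage m mean u ε t' x' ω ∂P := by
    rw [← integral_const_mul]
    refine integral_congr_ae ?_
    filter_upwards [hu.rescaledAverage_ae_eq hZ hmean_int κ₀ hε ht x,
      hu.rescaledAverage_ae_eq hZ hmean_int κ₀ hε ht' x'] with ω h1 h2
    rw [← h1, ← h2]
    have h3 : (√ε) ^ (-κ₀) = ε ^ (-κ₀ / 4) * ε ^ (-κ₀ / 4) := by
      rw [Real.sqrt_eq_rpow, ← Real.rpow_mul hε.le, ← Real.rpow_add hε]
      congr 1
      ring
    rw [h3]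
    linear_combination (ε ^ (-κ₀ / 4) * ε ^ (-κ₀ / 4) * centredAverage m mean u ε t x ω *
      centredAverage m mean u ε t' x' ω) * Real.mul_self_sqrt Real.pi_pos.le
  rw [h, Complex.ofReal_mul, hu.integral_centredAverage_mul hZ hε ht ht']
  push_cast
  ring

end IsSolutionField

/-! ### The spectral density of the covariance function `(1 + x²)^{-κ/2}` -/

/-- The integrand of `gammaMixtureDensity`. -/
def gammaMixtureIntegrand (κ d l s : ℝ) : ℝ :=
  s ^ (κ / 2 - 1) * Real.exp (-(d * s)) * gaussianPDFReal 0 (2 * s).toNNReal l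

/-- The (unnormalized) `Γ(κ/2, d)`-mixture of the centred Gaussian densities of variance `2s`. For
`d = 1` this is the spectral density of `(1 + x²)^{-κ/2}`. -/
def gammaMixtureDensity (κ d l : ℝ) : ℝ :=
  (Real.Gamma (κ / 2))⁻¹ * ∫ s in Set.Ioi 0, gammaMixtureIntegrand κ d l s

lemma measurable_gammaMixtureIntegrand (κ d : ℝ) :
    Measurable (fun p : ℝ × ℝ => gammaMixtureIntegrand κ d p.1 p.2) := by
  unfold gammaMixtureIntegrand gaussianPDFReal
  fun_prop

lemma measurable_gammaMixtureDensity (κ d : ℝ) : Measurable (gammaMixtureDensity κ d) :=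
  ((measurable_gammaMixtureIntegrand κ d).stronglyMeasurable.integral_prod_right).measurable.const_mul
    _

lemma gammaMixtureIntegrand_of_pos {κ d l s : ℝ} (hs : 0 < s) :
    gammaMixtureIntegrand κ d l s = s ^ (κ / 2 - 1) * Real.exp (-(d * s)) *
      ((2 * √Real.pi)⁻¹ * s ^ (-(1 / 2) : ℝ) * Real.exp (-(l ^ 2 / 4 * s⁻¹))) := by
  rw [gammaMixtureIntegrand, gaussianPDFReal, Real.coe_toNNReal _ (by positivity)]
  congr 2
  · rw [Real.rpow_neg hs.le, ← Real.sqrt_eq_rpow, ← mul_inv]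
    congr 1
    rw [show 2 * Real.pi * (2 * s) = (2 ^ 2 * Real.pi) * s by ring,
      Real.sqrt_mul (by positivity), Real.sqrt_mul (by positivity), Real.sqrt_sq (by positivity)]
  · congr 1
    field_simp
    ring

lemma gammaMixtureIntegrand_nonneg {κ d l s : ℝ} (hs : 0 < s) :
    0 ≤ gammaMixtureIntegrand κ d l s := by
  rw [gammaMixtureIntegrand_of_pos hs]
  positivity

lemma gammaMixtureIntegrand_le {κ d l s : ℝ} (hd : 0 ≤ d) (hs : 0 < s) :
    gammaMixtureIntegrand κ d l s ≤ gammaMixtureIntegrand κ 0 l s := by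
  rw [gammaMixtureIntegrand_of_pos hs, gammaMixtureIntegrand_of_pos hs]
  have : 0 ≤ d * s := by positivity
  gcongr

/-- The substitution s = 1/v turns this into the Gamma integral with exponent (1-κ)/2, which is
positive because κ < 1. -/
lemma setIntegral_gammaMixtureIntegrand_zero {κ l : ℝ} (hκ : κ < 1) (hl : l ≠ 0) :
    ∫ s in Set.Ioi 0, gammaMixtureIntegrand κ 0 l s =
      (2 * √Real.pi)⁻¹ * ((1 / (l ^ 2 / 4)) ^ ((1 - κ) / 2) * Real.Gamma ((1 - κ) / 2)) := by
  have hl2 : 0 < l ^ 2 / 4 := by positivity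
  rw [← integral_comp_rpow_Ioi _ (by norm_num : (-1 : ℝ) ≠ 0),
    ← Real.integral_rpow_mul_exp_neg_mul_Ioi (by linarith) hl2, ← integral_const_mul]
  refine setIntegral_congr_fun measurableSet_Ioi fun v hv => ?_
  have hv : 0 < v := hv
  have hv' : 0 < v ^ (-1 : ℝ) := by positivity
  simp only [smul_eq_mul]
  rw [gammaMixtureIntegrand_of_pos hv', zero_mul, neg_zero, Real.exp_zero, mul_one, abs_neg, abs_one,
    one_mul, Real.rpow_neg_one, inv_inv, ← Real.rpow_neg_one, ← Real.rpow_mul hv.le,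
    ← Real.rpow_mul hv.le]
  have h : v ^ ((1 - κ) / 2 - 1) =
      v ^ (-1 - 1 : ℝ) * v ^ (-1 * (κ / 2 - 1)) * v ^ (-1 * -(1 / 2) : ℝ) := by
    rw [← Real.rpow_add hv, ← Real.rpow_add hv]
    congr 1
    ring
  rw [h]
  ring

lemma integrableOn_gammaMixtureIntegrand_zero {κ l : ℝ} (hκ : κ < 1) (hl : l ≠ 0) :
    IntegrableOn (gammaMixtureIntegrand κ 0 l) (Set.Ioi 0) := by
  -- The Bochner integral of a non-integrable function is 0, so the nonzero value just computed
  -- proves integrability.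
  refine Integrable.of_integral_ne_zero ?_
  rw [setIntegral_gammaMixtureIntegrand_zero hκ hl]
  have := Real.Gamma_pos_of_pos (s := (1 - κ) / 2) (by linarith)
  positivity

lemma integrableOn_gammaMixtureIntegrand {κ d l : ℝ} (hκ : κ < 1) (hd : 0 ≤ d) (hl : l ≠ 0) :
    IntegrableOn (gammaMixtureIntegrand κ d l) (Set.Ioi 0) := by
  refine (integrableOn_gammaMixtureIntegrand_zero hκ hl).mono'
    ((measurable_gammaMixtureIntegrand κ d).comp measurable_prodMk_left).aestronglyMeasurable ?_
  refine ae_restrict_of_forall_mem measurableSet_Ioi fun s hs => ?_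
  rw [Real.norm_eq_abs, abs_of_nonneg (gammaMixtureIntegrand_nonneg hs)]
  exact gammaMixtureIntegrand_le hd hs

lemma gammaMixtureDensity_nonneg {κ d l : ℝ} (hκ : 0 < κ) : 0 ≤ gammaMixtureDensity κ d l :=
  mul_nonneg (inv_nonneg.2 (Real.Gamma_pos_of_pos (by linarith)).le)
    (setIntegral_nonneg measurableSet_Ioi fun _ hs => gammaMixtureIntegrand_nonneg hs)

lemma gammaMixtureDensity_le {κ d l : ℝ} (hκ : κ ∈ Set.Ioo (0 : ℝ) 1) (hd : 0 ≤ d) (hl : l ≠ 0) :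
    gammaMixtureDensity κ d l ≤ gammaMixtureDensity κ 0 l :=
  mul_le_mul_of_nonneg_left
    (setIntegral_mono_on (integrableOn_gammaMixtureIntegrand hκ.2 hd hl)
      (integrableOn_gammaMixtureIntegrand_zero hκ.2 hl) measurableSet_Ioi
      fun _ hs => gammaMixtureIntegrand_le hd hs)
    (inv_nonneg.2 (Real.Gamma_pos_of_pos (by linarith [hκ.1])).le)

/-- For `d = 0` the density is that of the Riesz kernel. -/
lemma gammaMixtureDensity_zero {κ l : ℝ} (hκ : κ ∈ Set.Ioo (0 : ℝ) 1) (hl : l ≠ 0) :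
    gammaMixtureDensity κ 0 l = c2 κ * |l| ^ (κ - 1) := by
  have h0 := hκ.1
  have h1 := hκ.2
  rw [gammaMixtureDensity, setIntegral_gammaMixtureIntegrand_zero hκ.2 hl, c2]
  have hl' : 0 < |l| := abs_pos.2 hl
  have e1 : (1 / (l ^ 2 / 4)) ^ ((1 - κ) / 2) = 2 ^ (1 - κ) * |l| ^ (κ - 1) := by
    rw [show 1 / (l ^ 2 / 4) = (2 * |l|⁻¹) ^ (2 : ℝ) by
        rw [Real.rpow_two, mul_pow, inv_pow, sq_abs]; field_simp; norm_num,
      ← Real.rpow_mul (by positivity), show 2 * ((1 - κ) / 2) = 1 - κ by ring,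
      Real.mul_rpow (by norm_num) (by positivity), Real.inv_rpow hl'.le, ← Real.rpow_neg hl'.le,
      neg_sub]
  -- Legendre duplication at κ/2 and reflection at (1+κ)/2 reduce the Gamma quotient to c₂(κ).
  have e2 := Real.Gamma_mul_Gamma_add_half (κ / 2)
  have e3 := Real.Gamma_mul_Gamma_one_sub ((1 + κ) / 2)
  rw [show 1 - (1 + κ) / 2 = (1 - κ) / 2 by ring,
    show Real.pi * ((1 + κ) / 2) = κ * Real.pi / 2 + Real.pi / 2 by ring,
    Real.sin_add_pi_div_two] at e3
  rw [show κ / 2 + 1 / 2 = (1 + κ) / 2 by ring, show 2 * (κ / 2) = κ by ring] at e2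
  have g1 := Real.Gamma_pos_of_pos (s := κ / 2) (by linarith)
  have g2 := Real.Gamma_pos_of_pos (s := (1 + κ) / 2) (by linarith)
  have g3 := Real.Gamma_pos_of_pos h0
  have hcos : 0 < Real.cos (κ * Real.pi / 2) := by
    refine Real.cos_pos_of_mem_Ioo ⟨?_, ?_⟩ <;> nlinarith [Real.pi_pos]
  have hpi : 0 < √Real.pi := Real.sqrt_pos.2 Real.pi_pos
  have hpp : √Real.pi * √Real.pi = Real.pi := Real.mul_self_sqrt Real.pi_pos.le
  have e4 : Real.Gamma ((1 - κ) / 2) * Real.Gamma ((1 + κ) / 2) * Real.cos (κ * Real.pi / 2) =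
      Real.pi := by
    rw [mul_comm (Real.Gamma ((1 - κ) / 2)), e3,
      div_mul_cancel₀ _ hcos.ne']
  rw [e1]
  have key : (Real.Gamma (κ / 2))⁻¹ * ((2 * √Real.pi)⁻¹ *
      (2 ^ (1 - κ) * Real.Gamma ((1 - κ) / 2))) =
      (2 * Real.Gamma κ * Real.cos (κ * Real.pi / 2))⁻¹ := by
    rw [← mul_inv_cancel_right₀ (mul_pos g2 hcos).ne' (Real.Gamma ((1 - κ) / 2)), ← mul_assoc
      (Real.Gamma ((1 - κ) / 2)), e4]
    have e5 : (2 : ℝ) ^ (1 - κ) =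
        Real.Gamma (κ / 2) * Real.Gamma ((1 + κ) / 2) / (Real.Gamma κ * √Real.pi) := by
      rw [e2]; field_simp
    rw [e5]
    field_simp
    linear_combination -hpp
  rw [← key]
  ring

lemma tendsto_gammaMixtureDensity {κ l : ℝ} (hκ : κ ∈ Set.Ioo (0 : ℝ) 1) (hl : l ≠ 0) :
    Tendsto (fun d => gammaMixtureDensity κ d l) (𝓝[>] 0) (𝓝 (gammaMixtureDensity κ 0 l)) := by
  refine Tendsto.const_mul _ (tendsto_integral_filter_of_dominated_convergence
    (gammaMixtureIntegrand κ 0 l) (Eventually.of_forall fun d =>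
      ((measurable_gammaMixtureIntegrand κ d).comp measurable_prodMk_left).aestronglyMeasurable)
    ?_ (integrableOn_gammaMixtureIntegrand_zero hκ.2 hl) ?_)
  · filter_upwards [self_mem_nhdsWithin] with d hd
    refine (ae_restrict_iff' measurableSet_Ioi).2 (ae_of_all _ fun s hs => ?_)
    rw [Real.norm_eq_abs, abs_of_nonneg (gammaMixtureIntegrand_nonneg hs)]
    exact gammaMixtureIntegrand_le (le_of_lt (Set.mem_Ioi.1 hd)) hs
  · refine ae_of_all _ fun s => ?_
    have : Continuous (fun d => gammaMixtureIntegrand κ d l s) := by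
      unfold gammaMixtureIntegrand
      fun_prop
    exact (this.tendsto 0).mono_left nhdsWithin_le_nhds

/-- By the substitution s ↦ δ²s. It converts the zoom at the origin into the limit d = δ² → 0 at a
fixed frequency. -/
lemma gammaMixtureDensity_mul {κ l δ : ℝ} (hδ : 0 < δ) :
    gammaMixtureDensity κ 1 (δ * l) = δ ^ (κ - 1) * gammaMixtureDensity κ (δ ^ 2) l := by
  have h := integral_comp_mul_left_Ioi (gammaMixtureIntegrand κ 1 (δ * l)) 0
    (by positivity : 0 < δ ^ 2)
  rw [mul_zero, smul_eq_mul, eq_inv_mul_iff_mul_eq₀ (by positivity)] at h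
  rw [gammaMixtureDensity, gammaMixtureDensity, mul_left_comm]
  congr 1
  rw [← h, ← integral_const_mul, ← integral_const_mul]
  refine setIntegral_congr_fun measurableSet_Ioi fun s hs => ?_
  have hs : 0 < s := hs
  rw [gammaMixtureIntegrand_of_pos hs, gammaMixtureIntegrand_of_pos (by positivity),
    Real.mul_rpow (by positivity) hs.le, Real.mul_rpow (by positivity) hs.le, ← Real.rpow_two,
    ← Real.rpow_mul hδ.le, ← Real.rpow_mul hδ.le,
    show (δ * l) ^ 2 / 4 * (δ ^ (2 : ℝ) * s)⁻¹ = l ^ 2 / 4 * s⁻¹ by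
      rw [Real.rpow_two]; field_simp, one_mul]
  have h2 : δ ^ (κ - 1) =
      δ ^ (2 : ℝ) * δ ^ (2 * (κ / 2 - 1)) * δ ^ (2 * -(1 / 2) : ℝ) := by
    rw [← Real.rpow_add hδ, ← Real.rpow_add hδ]
    congr 1
    ring
  rw [h2]
  ring

lemma integrableOn_rpow_mul_exp_neg {κ : ℝ} (hκ : 0 < κ) :
    IntegrableOn (fun s : ℝ => s ^ (κ / 2 - 1) * Real.exp (-(1 * s))) (Set.Ioi 0) := by
  simpa [mul_comm] using Real.GammaIntegral_convergent (s := κ / 2) (by linarith)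

lemma integrable_uncurry_gammaMixtureIntegrand {κ : ℝ} (hκ : 0 < κ) :
    Integrable (fun p : ℝ × ℝ => gammaMixtureIntegrand κ 1 p.2 p.1)
      ((volume.restrict (Set.Ioi 0)).prod volume) := by
  have hm : AEStronglyMeasurable (fun p : ℝ × ℝ => gammaMixtureIntegrand κ 1 p.2 p.1)
      ((volume.restrict (Set.Ioi 0)).prod volume) :=
    ((measurable_gammaMixtureIntegrand κ 1).comp measurable_swap).aestronglyMeasurable
  rw [integrable_prod_iff hm]
  refine ⟨ae_of_all _ fun s => (integrable_gaussianPDFReal 0 (2 * s).toNNReal).const_mul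
    (s ^ (κ / 2 - 1) * Real.exp (-(1 * s))), ?_⟩
  refine (integrableOn_rpow_mul_exp_neg hκ).congr_fun (fun s hs => ?_) measurableSet_Ioi
  have hs : 0 < s := hs
  have h : ∀ l, ‖gammaMixtureIntegrand κ 1 l s‖ = s ^ (κ / 2 - 1) * Real.exp (-(1 * s)) *
      gaussianPDFReal 0 (2 * s).toNNReal l := fun l => by
    rw [Real.norm_eq_abs, abs_of_nonneg (gammaMixtureIntegrand_nonneg hs), gammaMixtureIntegrand]
  simp_rw [h]
  rw [integral_const_mul, integral_gaussianPDFReal_eq_one, mul_one]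
  simpa using hs

lemma integrable_gammaMixtureDensity {κ : ℝ} (hκ : 0 < κ) :
    Integrable (gammaMixtureDensity κ 1) :=
  (integrable_uncurry_gammaMixtureIntegrand hκ).integral_prod_right.const_mul _

/-- The Fourier transform of the density is `(1 + x²)^{-κ/2}`. -/
lemma integral_cexp_mul_gammaMixtureDensity {κ : ℝ} (hκ : 0 < κ) (x : ℝ) :
    ∫ l : ℝ, Complex.exp (x * l * Complex.I) * (gammaMixtureDensity κ 1 l : ℂ) =
      (((1 + x ^ 2) ^ (κ / 2))⁻¹ : ℝ) := by
  have hg := Real.Gamma_pos_of_pos (s := κ / 2) (by linarith)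
  have h1 : ∀ l : ℝ, Complex.exp (x * l * Complex.I) * (gammaMixtureDensity κ 1 l : ℂ) =
      ((Real.Gamma (κ / 2))⁻¹ : ℝ) * ∫ s in Set.Ioi 0,
        Complex.exp (x * l * Complex.I) * (gammaMixtureIntegrand κ 1 l s : ℂ) := by
    intro l
    rw [gammaMixtureDensity, Complex.ofReal_mul, ← integral_complex_ofReal, integral_const_mul]
    ring
  simp_rw [h1]
  rw [integral_const_mul, ← integral_integral_swap (f := fun s l : ℝ =>
    Complex.exp (x * l * Complex.I) * (gammaMixtureIntegrand κ 1 l s : ℂ))]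
  · have h2 : ∫ s in Set.Ioi (0 : ℝ), ∫ l : ℝ,
        Complex.exp (x * l * Complex.I) * (gammaMixtureIntegrand κ 1 l s : ℂ) =
        ∫ s in Set.Ioi (0 : ℝ),
          ((s ^ (κ / 2 - 1) * Real.exp (-((1 + x ^ 2) * s)) : ℝ) : ℂ) := by
      refine setIntegral_congr_fun measurableSet_Ioi fun s hs => ?_
      have hs : 0 < s := hs
      -- With s fixed, the integral over l is the characteristic function exp(-s x²) of N(0, 2s);
      -- together with exp(-s) it leaves a Gamma integral in s.
      have h3 := charFun_gaussianReal (μ := 0) (v := (2 * s).toNNReal) x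
      rw [charFun_apply_real, integral_gaussianReal_eq_integral_smul (by simpa using hs)] at h3
      have h4 : ∀ l : ℝ, Complex.exp (x * l * Complex.I) * (gammaMixtureIntegrand κ 1 l s : ℂ) =
          ((s ^ (κ / 2 - 1) * Real.exp (-(1 * s)) : ℝ) : ℂ) *
            (gaussianPDFReal 0 (2 * s).toNNReal l • Complex.exp (x * l * Complex.I)) := by
        intro l
        rw [gammaMixtureIntegrand, Complex.real_smul]
        push_cast
        ring
      simp_rw [h4]
      rw [integral_const_mul, h3, Real.coe_toNNReal _ (by positivity), Complex.ofReal_mul,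
        Complex.ofReal_mul, mul_assoc, Complex.ofReal_mul, Complex.ofReal_exp,
        Complex.ofReal_exp, ← Complex.exp_add]
      congr 2
      push_cast
      ring
    rw [h2, integral_complex_ofReal,
      Real.integral_rpow_mul_exp_neg_mul_Ioi (by linarith) (by positivity), ← Complex.ofReal_mul,
      one_div, Real.inv_rpow (by positivity)]
    congr 1
    field_simp
  · refine (integrable_uncurry_gammaMixtureIntegrand hκ).ofReal.bdd_mul (c := 1)
      (Measurable.aestronglyMeasurable (by fun_prop)) (ae_of_all _ fun p => ?_)
    rw [← Complex.ofReal_mul, Complex.norm_exp_ofReal_mul_I]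

/-- A signed density with the characteristic function of a finite measure is its density. -/
lemma integral_eq_integral_mul_of_charFun_eq {F : Measure ℝ} [IsFiniteMeasure F] {D : ℝ → ℝ}
    (hDm : Measurable D) (hD : Integrable D)
    (h : ∀ x, charFun F x = ∫ l : ℝ, Complex.exp (x * l * Complex.I) * (D l : ℂ)) {g : ℝ → ℂ}
    (hg : Measurable g) {C : ℝ} (hC : ∀ l, ‖g l‖ ≤ C) :
    ∫ l, g l ∂F = ∫ l, g l * (D l : ℂ) := by
  have hpos : IsFiniteMeasure (volume.withDensity fun l => ENNReal.ofReal (D l)) :=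
    isFiniteMeasure_withDensity_ofReal hD.hasFiniteIntegral
  have hneg : IsFiniteMeasure (volume.withDensity fun l => ENNReal.ofReal (-D l)) :=
    isFiniteMeasure_withDensity_ofReal hD.neg.hasFiniteIntegral
  -- The negative part of D is moved to the side of F, so that two genuine finite measures are
  -- compared. Applied to the characters this gives their equality, then applied to g the claim; the
  -- bound C ⊔ 1 covers both uses.
  have key : ∀ {f : ℝ → ℂ}, Measurable f → (∀ l, ‖f l‖ ≤ C ⊔ 1) →
      ∫ l, f l ∂(F + volume.withDensity fun l => ENNReal.ofReal (-D l)) -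
        ∫ l, f l ∂(volume.withDensity fun l => ENNReal.ofReal (D l)) =
      ∫ l, f l ∂F - ∫ l, f l * (D l : ℂ) := by
    intro f hf hfC
    have hi : ∀ (ρ : Measure ℝ) [IsFiniteMeasure ρ], Integrable f ρ := fun ρ _ =>
      Integrable.of_bound hf.aestronglyMeasurable _ (ae_of_all _ hfC)
    have hfD : ∀ {E : ℝ → ℝ}, Integrable E →
        Integrable (fun l => (E l ⊔ 0) • f l) := by
      intro E hE
      have := (hE.pos_part.ofReal (𝕜 := ℂ)).mul_bdd (c := C ⊔ 1) hf.aestronglyMeasurable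
        (ae_of_all _ hfC)
      exact this
    rw [integral_add_measure (hi _) (hi _),
      integral_withDensity_eq_integral_toReal_smul (by fun_prop) (by simp),
      integral_withDensity_eq_integral_toReal_smul (by fun_prop) (by simp), add_sub_assoc,
      sub_eq_add_neg, sub_eq_add_neg (∫ l, f l ∂F)]
    congr 1
    simp only [ENNReal.toReal_ofReal']
    rw [← sub_eq_add_neg, ← integral_sub (hfD (E := fun l => -D l) hD.neg) (hfD hD), ← integral_neg]
    congr 1
    ext l
    have : D l = (D l ⊔ 0) - (-D l ⊔ 0) := by
      rcases le_total 0 (D l) with h | h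
      · rw [max_eq_left h, max_eq_right (by linarith)]; ring
      · rw [max_eq_right h, max_eq_left (by linarith)]; ring
    conv_rhs => rw [this]
    simp only [Complex.real_smul]
    push_cast
    ring
  have hEq : F + (volume.withDensity fun l => ENNReal.ofReal (-D l)) =
      volume.withDensity fun l => ENNReal.ofReal (D l) := by
    refine Measure.ext_of_charFun ?_
    ext x
    have h1 := key (f := fun l => Complex.exp (x * l * Complex.I)) (by fun_prop) (fun l => by
      rw [← Complex.ofReal_mul, Complex.norm_exp_ofReal_mul_I]; exact le_sup_right)
    rw [← charFun_apply_real, ← charFun_apply_real, ← charFun_apply_real, h x, sub_self] at h1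
    exact sub_eq_zero.1 h1
  have h1 := key hg fun l => (hC l).trans le_sup_left
  rw [hEq, sub_self] at h1
  exact (sub_eq_zero.1 h1.symm)

/-- The spectral density of `cyclicCovariance`. -/
def cyclicDensity {n : ℕ} (A w κ : Fin (n + 1) → ℝ) (l : ℝ) : ℝ :=
  ∑ j, A j / 2 * (gammaMixtureDensity (κ j) 1 (l - w j) + gammaMixtureDensity (κ j) 1 (l - -w j))

lemma measurable_cyclicDensity {n : ℕ} (A w κ : Fin (n + 1) → ℝ) :
    Measurable (cyclicDensity A w κ) := by
  have h := fun j => measurable_gammaMixtureDensity (κ j) 1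
  unfold cyclicDensity
  fun_prop

lemma integrable_cyclicDensity {n : ℕ} {A w κ : Fin (n + 1) → ℝ}
    (hκ : ∀ j, κ j ∈ Set.Ioo (0 : ℝ) 1) : Integrable (cyclicDensity A w κ) :=
  integrable_finsetSum _ fun j _ =>
    (((integrable_gammaMixtureDensity (hκ j).1).comp_sub_right _).add
      ((integrable_gammaMixtureDensity (hκ j).1).comp_sub_right _)).const_mul _

lemma integral_mul_cyclicDensity {n : ℕ} {A w κ : Fin (n + 1) → ℝ}
    (hκ : ∀ j, κ j ∈ Set.Ioo (0 : ℝ) 1) {g : ℝ → ℂ} (hg : Measurable g) {C : ℝ}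
    (hC : ∀ l, ‖g l‖ ≤ C) :
    ∫ l, g l * (cyclicDensity A w κ l : ℂ) = ∑ j, (A j : ℂ) / 2 *
      ((∫ l, g l * (gammaMixtureDensity (κ j) 1 (l - w j) : ℂ)) +
        ∫ l, g l * (gammaMixtureDensity (κ j) 1 (l - -w j) : ℂ)) := by
  have hi : ∀ j v, Integrable (fun l => g l * (gammaMixtureDensity (κ j) 1 (l - v) : ℂ)) :=
    fun j v => ((integrable_gammaMixtureDensity (hκ j).1).comp_sub_right v).ofReal.bdd_mul
      hg.aestronglyMeasurable (ae_of_all _ hC)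
  simp_rw [← integral_add (hi _ _) (hi _ _), ← integral_const_mul]
  have hi2 : ∀ j, Integrable (fun l => (A j : ℂ) / 2 *
      (g l * (gammaMixtureDensity (κ j) 1 (l - w j) : ℂ) +
        g l * (gammaMixtureDensity (κ j) 1 (l - -w j) : ℂ))) := fun j =>
    ((hi _ _).add (hi _ _)).const_mul _
  rw [← integral_finsetSum _ fun j _ => hi2 j]
  congr 1
  ext l
  rw [cyclicDensity, Complex.ofReal_sum, Finset.mul_sum]
  refine Finset.sum_congr rfl fun j _ => ?_
  push_cast
  ring

/-- Shifting the density by v multiplies its transform by exp(ixv); the half-sum over v = ±w_j is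
the cosine. -/
lemma integral_cexp_mul_cyclicDensity {n : ℕ} {A w κ : Fin (n + 1) → ℝ}
    (hκ : ∀ j, κ j ∈ Set.Ioo (0 : ℝ) 1) (x : ℝ) :
    ∫ l : ℝ, Complex.exp (x * l * Complex.I) * (cyclicDensity A w κ l : ℂ) =
      cyclicCovariance A w κ x := by
  have hshift : ∀ j (v : ℝ), ∫ l : ℝ, Complex.exp (x * l * Complex.I) *
      (gammaMixtureDensity (κ j) 1 (l - v) : ℂ) =
      Complex.exp (x * v * Complex.I) * (((1 + x ^ 2) ^ (κ j / 2))⁻¹ : ℝ) := by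
    intro j v
    rw [← integral_cexp_mul_gammaMixtureDensity (hκ j).1, ← integral_const_mul]
    refine Eq.trans ?_ (integral_sub_right_eq_self _ v)
    congr 1
    ext l
    rw [← mul_assoc, ← Complex.exp_add]
    congr 2
    push_cast
    ring
  rw [integral_mul_cyclicDensity hκ (by fun_prop) (C := 1) fun l => by
      rw [← Complex.ofReal_mul, Complex.norm_exp_ofReal_mul_I],
    cyclicCovariance, Complex.ofReal_sum]
  refine Finset.sum_congr rfl fun j _ => ?_
  rw [hshift, hshift, Complex.ofReal_mul, Complex.ofReal_div, Complex.ofReal_cos, Complex.cos]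
  push_cast
  rw [show (x : ℂ) * -(w j : ℂ) * Complex.I = -(w j * x) * Complex.I by ring,
    show (x : ℂ) * (w j : ℂ) * Complex.I = w j * x * Complex.I by ring]
  ring

/-! ### The spectral measure near the origin -/

lemma integral_exp_mul_abs_rpow_pos {κ : ℝ} (hκ : 0 < κ) :
    0 < ∫ l : ℝ, Real.exp (-l ^ 2 / 2) * |l| ^ (κ - 1) := by
  have h := integral_comp_abs (f := fun x : ℝ => Real.exp (-x ^ 2 / 2) * x ^ (κ - 1))
  simp only [sq_abs] at h
  have h2 : ∫ x in Set.Ioi (0 : ℝ), Real.exp (-x ^ 2 / 2) * x ^ (κ - 1) =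
      ∫ x in Set.Ioi (0 : ℝ), x ^ (κ - 1) * Real.exp (-(1 / 2) * x ^ (2 : ℝ)) := by
    refine setIntegral_congr_fun measurableSet_Ioi fun x _ => ?_
    rw [mul_comm, Real.rpow_two]
    congr 2
    ring
  rw [h, h2, integral_rpow_mul_exp_neg_mul_rpow (by norm_num) (by linarith) (by norm_num)]
  have := Real.Gamma_pos_of_pos (s := (κ - 1 + 1) / 2) (by linarith)
  positivity

lemma integrable_exp_mul_abs_rpow {κ : ℝ} (hκ : 0 < κ) :
    Integrable (fun l : ℝ => Real.exp (-l ^ 2 / 2) * |l| ^ (κ - 1)) :=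
  Integrable.of_integral_ne_zero (integral_exp_mul_abs_rpow_pos hκ).ne'

/-- After l ↦ δl the powers of δ cancel, δ^(-κ) · δ · δ^(κ-1) = 1, and only the parameter d = δ²
depends on δ. The Riesz density times exp(-l²/2) dominates for all d; l = 0 is discarded as a null
set. -/
lemma tendsto_integral_comp_div_mul_gammaMixtureDensity {κ : ℝ} (hκ : κ ∈ Set.Ioo (0 : ℝ) 1)
    {G : ℝ → ℂ} (hG : Measurable G) (hGb : ∀ l, ‖G l‖ ≤ Real.exp (-l ^ 2 / 2)) :
    Tendsto (fun δ : ℝ => (δ ^ (-κ) : ℝ) * ∫ l, G (l / δ) * (gammaMixtureDensity κ 1 l : ℂ))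
      (𝓝[>] 0) (𝓝 (c2 κ * ∫ l, G l * (|l| ^ (κ - 1) : ℝ))) := by
  have hne : ∀ᵐ l : ℝ, l ≠ 0 := by simp [ae_iff]
  have h1 : ∀ δ : ℝ, 0 < δ →
      (δ ^ (-κ) : ℝ) * ∫ l, G (l / δ) * (gammaMixtureDensity κ 1 l : ℂ) =
      ∫ l, G l * (gammaMixtureDensity κ (δ ^ 2) l : ℂ) := by
    intro δ hδ
    have h2 := Measure.integral_comp_mul_left
      (fun l => G (l / δ) * (gammaMixtureDensity κ 1 l : ℂ)) δ
    rw [abs_of_pos (inv_pos.2 hδ), Complex.real_smul] at h2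
    have h3 : ∫ l, G (l / δ) * (gammaMixtureDensity κ 1 l : ℂ) =
        (δ : ℂ) * ∫ l, G (δ * l / δ) * (gammaMixtureDensity κ 1 (δ * l) : ℂ) := by
      rw [h2, ← mul_assoc, ← Complex.ofReal_mul, mul_inv_cancel₀ hδ.ne', Complex.ofReal_one, one_mul]
    rw [h3, ← mul_assoc, ← Complex.ofReal_mul, ← integral_const_mul]
    congr 1
    ext l
    rw [gammaMixtureDensity_mul hδ, mul_div_cancel_left₀ _ hδ.ne', Complex.ofReal_mul (δ ^ (κ - 1))]
    have h4 : δ ^ (-κ) * δ * δ ^ (κ - 1) = 1 := by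
      nth_rewrite 2 [← Real.rpow_one δ]
      rw [← Real.rpow_add hδ, ← Real.rpow_add hδ]
      simp
    have h5 : ((δ ^ (-κ) * δ : ℝ) : ℂ) * ((δ ^ (κ - 1) : ℝ) : ℂ) = 1 := by
      rw [← Complex.ofReal_mul, h4, Complex.ofReal_one]
    linear_combination (G l * (gammaMixtureDensity κ (δ ^ 2) l : ℂ)) * h5
  have hlim : ∫ l, G l * (gammaMixtureDensity κ 0 l : ℂ) =
      c2 κ * ∫ l, G l * (|l| ^ (κ - 1) : ℝ) := by
    rw [← integral_const_mul]
    refine integral_congr_ae ?_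
    filter_upwards [hne] with l hl
    rw [gammaMixtureDensity_zero hκ hl]
    push_cast
    ring
  rw [← hlim]
  have h0 : Tendsto (fun δ : ℝ => δ ^ 2) (𝓝[>] 0) (𝓝[>] 0) := by
    refine tendsto_nhdsWithin_iff.2 ⟨?_, ?_⟩
    · have : Tendsto (fun δ : ℝ => δ ^ 2) (𝓝 0) (𝓝 (0 ^ 2)) := (continuous_pow 2).tendsto 0
      rw [zero_pow two_ne_zero] at this
      exact this.mono_left nhdsWithin_le_nhds
    · filter_upwards [self_mem_nhdsWithin] with δ hδ
      exact pow_pos (Set.mem_Ioi.1 hδ) 2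
  have hdct : Tendsto (fun d : ℝ => ∫ l, G l * (gammaMixtureDensity κ d l : ℂ)) (𝓝[>] 0)
      (𝓝 (∫ l, G l * (gammaMixtureDensity κ 0 l : ℂ))) := by
    refine tendsto_integral_filter_of_dominated_convergence
      (fun l => c2 κ * (Real.exp (-l ^ 2 / 2) * |l| ^ (κ - 1))) ?_ ?_
      ((integrable_exp_mul_abs_rpow hκ.1).const_mul _) ?_
    · refine Eventually.of_forall fun d => Measurable.aestronglyMeasurable ?_
      have := measurable_gammaMixtureDensity κ d
      fun_prop
    · filter_upwards [self_mem_nhdsWithin] with d hd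
      filter_upwards [hne] with l hl
      rw [norm_mul, Complex.norm_real, Real.norm_eq_abs, abs_of_nonneg
        (gammaMixtureDensity_nonneg hκ.1), mul_left_comm, ← gammaMixtureDensity_zero hκ hl]
      exact mul_le_mul (hGb l) (gammaMixtureDensity_le hκ (le_of_lt (Set.mem_Ioi.1 hd)) hl)
        (gammaMixtureDensity_nonneg hκ.1) (Real.exp_pos _).le
    · filter_upwards [hne] with l hl
      exact ((Complex.continuous_ofReal.tendsto _).comp
        (tendsto_gammaMixtureDensity hκ hl)).const_mul _
  refine (hdct.comp h0).congr' ?_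
  filter_upwards [self_mem_nhdsWithin] with δ hδ
  exact (h1 δ hδ).symm

/-- Split at |l| = |w|/2. Inside, l - w stays away from the singularity, the density is bounded, and
the Gaussian of width δ has mass O(δ). Outside, the Gaussian factor itself is O(δ) and the density
is integrable. -/
lemma norm_integral_comp_div_mul_gammaMixtureDensity_le {κ : ℝ} (hκ : κ ∈ Set.Ioo (0 : ℝ) 1)
    {w : ℝ} (hw : w ≠ 0) {G : ℝ → ℂ} (hGb : ∀ l, ‖G l‖ ≤ Real.exp (-l ^ 2 / 2)) :
    ∃ K : ℝ, ∀ δ : ℝ, 0 < δ → δ ≤ 1 →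
      ‖∫ l, G (l / δ) * (gammaMixtureDensity κ 1 (l - w) : ℂ)‖ ≤ K * δ := by
  have hw' : 0 < |w| := abs_pos.2 hw
  -- The Riesz density at distance |w|/2, a bound for the mixture at all larger distances.
  set C := |c2 κ| * (|w| / 2) ^ (κ - 1) with hC
  have hI := integrable_gammaMixtureDensity hκ.1
  refine ⟨C * √(Real.pi / (1 / 2)) + 8 / w ^ 2 * ∫ l, gammaMixtureDensity κ 1 l,
    fun δ hδ hδ1 => ?_⟩
  have hgauss : Integrable fun l : ℝ => Real.exp (-(1 / 2) * (l / δ) ^ 2) :=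
    (integrable_exp_neg_mul_sq (by norm_num : (0 : ℝ) < 1 / 2)).comp_div hδ.ne'
  have hb : ∀ l, ‖G (l / δ) * (gammaMixtureDensity κ 1 (l - w) : ℂ)‖ ≤
      C * Real.exp (-(1 / 2) * (l / δ) ^ 2) +
        8 / w ^ 2 * δ * gammaMixtureDensity κ 1 (l - w) := by
    intro l
    have hf := gammaMixtureDensity_nonneg (d := 1) (l := l - w) hκ.1
    rw [norm_mul, Complex.norm_real, Real.norm_eq_abs, abs_of_nonneg hf]
    have hG : ‖G (l / δ)‖ ≤ Real.exp (-(1 / 2) * (l / δ) ^ 2) :=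
      (hGb _).trans (le_of_eq (by congr 1; ring))
    rcases le_total |l| (|w| / 2) with h | h
    · have h1 : |w| / 2 ≤ |l - w| := by
        have := abs_sub_abs_le_abs_sub w l
        rw [abs_sub_comm] at this
        linarith
      have h2 : l - w ≠ 0 := abs_pos.1 (by linarith)
      have h3 : gammaMixtureDensity κ 1 (l - w) ≤ C := by
        refine (gammaMixtureDensity_le hκ zero_le_one h2).trans ?_
        rw [gammaMixtureDensity_zero hκ h2]
        exact mul_le_mul (le_abs_self _)
          (Real.rpow_le_rpow_of_nonpos (by positivity) h1 (by linarith [hκ.2]))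
          (by positivity) (by positivity)
      have h4 : ‖G (l / δ)‖ * gammaMixtureDensity κ 1 (l - w) ≤
          Real.exp (-(1 / 2) * (l / δ) ^ 2) * C :=
        mul_le_mul hG h3 hf (Real.exp_pos _).le
      have h5 : 0 ≤ 8 / w ^ 2 * δ * gammaMixtureDensity κ 1 (l - w) := by positivity
      linarith
    · have h1 : w ^ 2 / 8 / δ ^ 2 ≤ (1 / 2) * (l / δ) ^ 2 := by
        rw [div_pow, ← mul_div_assoc]
        gcongr
        have := mul_self_le_mul_self (by positivity) h
        rw [← sq, ← sq, sq_abs, div_pow, sq_abs] at this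
        linarith
      have hpos : 0 < w ^ 2 / 8 / δ ^ 2 := by positivity
      have h2 : Real.exp (-(1 / 2) * (l / δ) ^ 2) ≤ 8 / w ^ 2 * δ := by
        have h3 : Real.exp (-(1 / 2) * (l / δ) ^ 2) ≤ Real.exp (-(w ^ 2 / 8 / δ ^ 2)) :=
          Real.exp_le_exp.2 (by linarith)
        -- The crude bound exp(-a) ≤ 1/a, from a + 1 ≤ exp(a), already gives O(δ²).
        have h4 : Real.exp (-(w ^ 2 / 8 / δ ^ 2)) ≤ (w ^ 2 / 8 / δ ^ 2)⁻¹ := by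
          rw [Real.exp_neg]
          refine inv_anti₀ hpos ?_
          linarith [Real.add_one_le_exp (w ^ 2 / 8 / δ ^ 2)]
        have h5 : (w ^ 2 / 8 / δ ^ 2)⁻¹ = 8 / w ^ 2 * (δ * δ) := by
          field_simp
        have h6 : 8 / w ^ 2 * (δ * δ) ≤ 8 / w ^ 2 * (δ * 1) := by gcongr
        linarith
      have h3 : ‖G (l / δ)‖ * gammaMixtureDensity κ 1 (l - w) ≤
          8 / w ^ 2 * δ * gammaMixtureDensity κ 1 (l - w) :=
        mul_le_mul_of_nonneg_right (hG.trans h2) hf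
      have h4 : 0 ≤ C * Real.exp (-(1 / 2) * (l / δ) ^ 2) := by positivity
      linarith
  refine (norm_integral_le_of_norm_le
    ((hgauss.const_mul C).add ((hI.comp_sub_right w).const_mul _)) (ae_of_all _ hb)).trans
    (le_of_eq ?_)
  simp only [Pi.add_apply]
  rw [integral_add (hgauss.const_mul C) ((hI.comp_sub_right w).const_mul _), integral_const_mul,
    integral_const_mul, Measure.integral_comp_div (fun l : ℝ => Real.exp (-(1 / 2) * l ^ 2)),
    integral_gaussian, integral_sub_right_eq_self (gammaMixtureDensity κ 1), abs_of_pos hδ,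
    smul_eq_mul]
  ring

lemma tendsto_integral_comp_div_mul_gammaMixtureDensity_sub {κ κ₀ : ℝ}
    (hκ : κ ∈ Set.Ioo (0 : ℝ) 1) (hκ₀ : κ₀ < 1) {w : ℝ} (hw : w ≠ 0) {G : ℝ → ℂ}
    (hGb : ∀ l, ‖G l‖ ≤ Real.exp (-l ^ 2 / 2)) :
    Tendsto (fun δ : ℝ =>
      (δ ^ (-κ₀) : ℝ) * ∫ l, G (l / δ) * (gammaMixtureDensity κ 1 (l - w) : ℂ))
      (𝓝[>] 0) (𝓝 0) := by
  obtain ⟨K, hK⟩ := norm_integral_comp_div_mul_gammaMixtureDensity_le hκ hw hGb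
  have h0 : Tendsto (fun δ : ℝ => K * δ ^ (1 - κ₀)) (𝓝[>] 0) (𝓝 0) := by
    have h1 : Tendsto (fun δ : ℝ => δ ^ (1 - κ₀)) (𝓝 0) (𝓝 (0 ^ (1 - κ₀))) :=
      (Real.continuousAt_rpow_const _ _ (Or.inr (by linarith))).tendsto
    rw [Real.zero_rpow (by linarith)] at h1
    simpa using (h1.mono_left nhdsWithin_le_nhds).const_mul K
  refine squeeze_zero_norm' ?_ h0
  filter_upwards [Ioc_mem_nhdsGT (zero_lt_one' ℝ)] with δ hδ
  have hδ0 : 0 < δ := hδ.1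
  rw [norm_mul, Complex.norm_real, Real.norm_eq_abs, abs_of_nonneg (by positivity)]
  refine (mul_le_mul_of_nonneg_left (hK δ hδ0 hδ.2) (by positivity)).trans (le_of_eq ?_)
  rw [sub_eq_neg_add, Real.rpow_add hδ0, Real.rpow_one]
  ring

/-- A measure with characteristic function `cyclicCovariance` looks, near the origin, like
`A₀ c₂(κ₀) |l|^{κ₀ - 1} dl`. -/
lemma tendsto_integral_comp_div {n : ℕ} {A w κ : Fin (n + 1) → ℝ}
    (hpar : IsCyclicParameters A w κ) {F : Measure ℝ} [IsFiniteMeasure F]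
    (hF : ∀ x, charFun F x = cyclicCovariance A w κ x) {G : ℝ → ℂ} (hG : Measurable G)
    (hGb : ∀ l, ‖G l‖ ≤ Real.exp (-l ^ 2 / 2)) :
    Tendsto (fun δ : ℝ => (δ ^ (-κ 0) : ℝ) * ∫ l, G (l / δ) ∂F) (𝓝[>] 0)
      (𝓝 ((A 0 * c2 (κ 0) : ℝ) * ∫ l, G l * (|l| ^ (κ 0 - 1) : ℝ))) := by
  have hb1 : ∀ l, ‖G l‖ ≤ 1 := fun l => (hGb l).trans (by
    rw [Real.exp_le_one_iff]; have := sq_nonneg l; linarith)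
  have h1 : ∀ δ : ℝ, (δ ^ (-κ 0) : ℝ) * ∫ l, G (l / δ) ∂F = ∑ j, (A j : ℂ) / 2 *
      ((δ ^ (-κ 0) : ℝ) * (∫ l, G (l / δ) * (gammaMixtureDensity (κ j) 1 (l - w j) : ℂ)) +
      (δ ^ (-κ 0) : ℝ) * ∫ l, G (l / δ) * (gammaMixtureDensity (κ j) 1 (l - -w j) : ℂ)) := by
    intro δ
    have hGm : Measurable fun l => G (l / δ) := by fun_prop
    rw [integral_eq_integral_mul_of_charFun_eq (measurable_cyclicDensity A w κ)
      (integrable_cyclicDensity hpar.kappa_mem)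
      (fun x => by rw [hF x, integral_cexp_mul_cyclicDensity hpar.kappa_mem]) hGm
      (fun l => hb1 _), integral_mul_cyclicDensity hpar.kappa_mem hGm (fun l => hb1 _),
      Finset.mul_sum]
    refine Finset.sum_congr rfl fun j _ => ?_
    ring
  simp_rw [h1]
  -- The limit is written as a sum over j supported at j = 0, to pass to the limit term by term. At
  -- j = 0 the two shifted densities coincide, which compensates the factor 1/2.
  have h2 : ((A 0 * c2 (κ 0) : ℝ) * ∫ l, G l * (|l| ^ (κ 0 - 1) : ℝ) : ℂ) =
      ∑ j, if j = 0 then (A j : ℂ) / 2 * (c2 (κ j) * (∫ l, G l * (|l| ^ (κ j - 1) : ℝ)) +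
        c2 (κ j) * ∫ l, G l * (|l| ^ (κ j - 1) : ℝ)) else 0 := by
    rw [Finset.sum_ite_eq' Finset.univ 0, if_pos (Finset.mem_univ _)]
    push_cast
    ring
  rw [h2]
  refine tendsto_finsetSum _ fun j _ => ?_
  split_ifs with hj
  · subst hj
    have h := tendsto_integral_comp_div_mul_gammaMixtureDensity (hpar.kappa_mem 0) hG hGb
    simp only [hpar.w_zero, neg_zero, sub_zero]
    exact (h.add h).const_mul _
  · have hw := hpar.w_ne_zero j hj
    simpa using ((tendsto_integral_comp_div_mul_gammaMixtureDensity_sub (hpar.kappa_mem j)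
      (hpar.kappa_mem 0).2 hw hGb).add
      (tendsto_integral_comp_div_mul_gammaMixtureDensity_sub (hpar.kappa_mem j)
      (hpar.kappa_mem 0).2 (neg_ne_zero.2 hw) hGb)).const_mul ((A j : ℂ) / 2)

/-- The signs of the A_j are free, but this product times a positive integral is a limit of
integrals of a positive function against F. Hence the square root in the limit field is a genuine
one. -/
lemma mul_c2_nonneg {n : ℕ} {A w κ : Fin (n + 1) → ℝ}
    (hpar : IsCyclicParameters A w κ) {F : Measure ℝ} [IsFiniteMeasure F]
    (hF : ∀ x, charFun F x = cyclicCovariance A w κ x) : 0 ≤ A 0 * c2 (κ 0) := by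
  have h := tendsto_integral_comp_div hpar hF (G := fun l => (Real.exp (-l ^ 2 / 2) : ℝ))
    (by fun_prop) (fun l => by rw [Complex.norm_real, Real.norm_eq_abs, Real.abs_exp])
  simp_rw [← Complex.ofReal_mul] at h
  rw [integral_complex_ofReal, ← Complex.ofReal_mul] at h
  have h2 := (Complex.continuous_re.tendsto _).comp h
  have h3 := ge_of_tendsto h2 (b := 0) (by
    filter_upwards [self_mem_nhdsWithin] with δ hδ
    have hδ : 0 < δ := hδ
    simp only [Function.comp]
    rw [integral_complex_ofReal, ← Complex.ofReal_mul, Complex.ofReal_re]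
    exact mul_nonneg (by positivity) (integral_nonneg fun _ => (Real.exp_pos _).le))
  rw [Complex.ofReal_re] at h3
  exact nonneg_of_mul_nonneg_left h3 (integral_exp_mul_abs_rpow_pos (hpar.kappa_mem 0).1)

/-! ### The limit theorem -/

/-- The isometry identifies the covariance of η at 0 and x with the characteristic function of F.
Symmetry of the covariance is used to get exp(ixl) and not its conjugate. -/
lemma charFun_eq_cyclicCovariance {Ω : Type*} [MeasurableSpace Ω] {P : Measure Ω}
    [IsProbabilityMeasure P] {F : Measure ℝ} {Z : Set ℝ → Ω → ℂ}
    (hZ : IsGaussianRandomMeasure P F Z) {M : ℝ → ℝ} {η : ℝ → Ω → ℝ}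
    (hη : ∀ x, HasStochIntegral P F Z
      (fun l => Complex.exp (Complex.I * ((l * x : ℝ) : ℂ)))
      (fun ω => ((η x ω - M x : ℝ) : ℂ)))
    {n : ℕ} {A w κ : Fin (n + 1) → ℝ}
    (hcov : ∀ y x, cov[η y, η (y + x); P] = cyclicCovariance A w κ x) (x : ℝ) :
    charFun F x = cyclicCovariance A w κ x := by
  have hG := fun x => (hη x).inGaussianSpace hZ
  have hint : ∀ x, Integrable (η x) P := fun x => by
    exact (((hG x).memLp.integrable (by norm_num)).add (integrable_const (M x))).congr
      (ae_of_all _ fun ω => sub_add_cancel _ _)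
  rw [← hcov 0 x, covariance_comm, ← covariance_sub_const_left (hint (0 + x)) (M (0 + x)),
    ← covariance_sub_const_right (hint 0) (M 0), (hG (0 + x)).covariance_eq hZ (hG 0),
    (hη (0 + x)).integral_mul_eq hZ (hη 0), charFun_apply_real]
  congr 1
  ext l
  rw [cexp_I_mul_conj]
  congr 1
  push_cast
  ring

lemma continuous_averageKernel (μ : ℝ) (m : ℕ) (t x t' x' : ℝ) :
    Continuous (averageKernel μ m t x t' x') := by
  unfold averageKernel phase
  fun_prop

lemma norm_averageKernel (μ : ℝ) (m : ℕ) (t x t' x' l : ℝ) :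
    ‖averageKernel μ m t x t' x' l‖ = Real.exp (-l ^ 2 / 2) := by
  rw [averageKernel, norm_mul, norm_cexp_I_mul_ofReal, one_mul, Complex.norm_real,
    Real.norm_eq_abs, Real.abs_exp]

lemma integral_averageKernel_mul_re {κ : ℝ} (hκ : 0 < κ) (μ : ℝ) (m : ℕ) (t x t' x' : ℝ) :
    (∫ l, averageKernel μ m t x t' x' l * (|l| ^ (κ - 1) : ℝ)).re =
      ∫ l : ℝ, Real.cos (l * (x - x') + μ * (-1) ^ ((m - 1) / 2) * (t - t') * l ^ m) /
        |l| ^ (1 - κ) * Real.exp (-l ^ 2 / 2) := by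
  have hint : Integrable fun l => averageKernel μ m t x t' x' l * (|l| ^ (κ - 1) : ℝ) := by
    refine (integrable_exp_mul_abs_rpow hκ).mono' (Measurable.aestronglyMeasurable ?_)
      (ae_of_all _ fun l => ?_)
    · have := (continuous_averageKernel μ m t x t' x').measurable
      fun_prop
    · rw [norm_mul, norm_averageKernel, Complex.norm_real, Real.norm_eq_abs,
        abs_of_nonneg (by positivity)]
  refine (integral_re hint).symm.trans ?_
  congr 1
  ext l
  rw [RCLike.re_eq_complex_re, Complex.re_mul_ofReal, averageKernel, Complex.re_mul_ofReal,
    mul_comm Complex.I, Complex.exp_ofReal_mul_I_re, ← neg_sub 1 κ, Real.rpow_neg (abs_nonneg l)]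
  have : phase μ m t x l - phase μ m t' x' l =
      l * (x - x') + μ * (-1) ^ ((m - 1) / 2) * (t - t') * l ^ m := by
    unfold phase
    ring
  rw [this]
  ring

/-- The spectral representation of the covariance of the limit field. -/
lemma integral_limitField_mul {Ω' : Type*} [MeasurableSpace Ω'] {P' : Measure Ω'}
    {W : Set ℝ → Ω' → ℂ} (hW : IsGaussianRandomMeasure P' volume W) {μ : ℝ} {m : ℕ} {a κ : ℝ}
    (ha : 0 ≤ a) (hκ : κ < 1) {t x t' x' : ℝ} {y y' : Ω' → ℝ}
    (hy : HasStochIntegral P' volume W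
      (fun l => ((√a / (2 * √Real.pi) : ℝ) : ℂ) *
        (Complex.exp (Complex.I * (phase μ m t x l : ℂ)) / ((|l| ^ ((1 - κ) / 2) : ℝ) : ℂ) *
          ((Real.exp (-l ^ 2 / 4) : ℝ) : ℂ)))
      (fun ω => (y ω : ℂ)))
    (hy' : HasStochIntegral P' volume W
      (fun l => ((√a / (2 * √Real.pi) : ℝ) : ℂ) *
        (Complex.exp (Complex.I * (phase μ m t' x' l : ℂ)) / ((|l| ^ ((1 - κ) / 2) : ℝ) : ℂ) *
          ((Real.exp (-l ^ 2 / 4) : ℝ) : ℂ)))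
      (fun ω => (y' ω : ℂ))) :
    ((∫ ω, y ω * y' ω ∂P' : ℝ) : ℂ) =
      (a / (4 * Real.pi) : ℝ) *
        ∫ l, averageKernel μ m t x t' x' l * (|l| ^ (κ - 1) : ℝ) := by
  rw [hy.integral_mul_eq hW hy', ← integral_const_mul]
  congr 1
  ext l
  simp only [map_mul, map_div₀, Complex.conj_ofReal]
  rw [averageKernel, ← cexp_I_mul_conj]
  have h1 : (a / (4 * Real.pi) : ℝ) = (√a / (2 * √Real.pi)) * (√a / (2 * √Real.pi)) := by
    rw [div_mul_div_comm, Real.mul_self_sqrt ha]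
    congr 1
    linear_combination -4 * Real.mul_self_sqrt Real.pi_pos.le
  -- Adding the nonnegative exponents before inverting keeps the identity valid at l = 0 as well.
  have h2 : |l| ^ (κ - 1) = (|l| ^ ((1 - κ) / 2))⁻¹ * (|l| ^ ((1 - κ) / 2))⁻¹ := by
    rw [← mul_inv, ← Real.rpow_add_of_nonneg (abs_nonneg l) (by linarith) (by linarith),
      ← Real.rpow_neg (abs_nonneg l)]
    congr 1
    ring
  have h3 : Real.exp (-l ^ 2 / 2) = Real.exp (-l ^ 2 / 4) * Real.exp (-l ^ 2 / 4) := by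
    rw [← Real.exp_add]
    ring_nf
  rw [h1, h2, h3]
  push_cast
  ring

lemma tendsto_sqrt_comap_Ioi :
    Tendsto (fun ε : Set.Ioi (0 : ℝ) => √(ε : ℝ)) (comap Subtype.val (𝓝 (0 : ℝ))) (𝓝[>] 0) := by
  refine tendsto_nhdsWithin_iff.2 ⟨?_, Eventually.of_forall fun ε => Real.sqrt_pos.2 ε.2⟩
  have := (Real.continuous_sqrt.tendsto 0).comp
    (tendsto_comap (f := (Subtype.val : Set.Ioi (0 : ℝ) → ℝ)) (x := 𝓝 0))
  rwa [Real.sqrt_zero] at this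

/-- An arbitrary factor c treats both normalizations at once. The constants match because (2πc)² ·
a/(4π) = c²π · a with a = A₀c₂(κ₀). -/
lemma tendstoFDD_rescaledAverage
    {Ω Ω' : Type*} [MeasurableSpace Ω] [MeasurableSpace Ω']
    {P : Measure Ω} [IsProbabilityMeasure P] {P' : Measure Ω'} [IsProbabilityMeasure P']
    {m : ℕ} {μ c : ℝ} {F : Measure ℝ} [IsFiniteMeasure F] {Z : Set ℝ → Ω → ℂ}
    (hZ : IsGaussianRandomMeasure P F Z)
    {n : ℕ} {A w κ : Fin (n + 1) → ℝ} (hpar : IsCyclicParameters A w κ)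
    (hF : ∀ x, charFun F x = cyclicCovariance A w κ x)
    {mean : ℝ → ℝ → ℝ}
    (hmean_int : ∀ t, 0 < t → ∀ ε, 0 < ε → ∀ x,
      Integrable (fun x₁ : ℝ => Real.exp (-(x₁ - x) ^ 2) * mean t (x₁ / √ε)))
    {v : ℝ → ℝ → Ω → ℝ} (hv : IsSolutionField P F Z c μ m mean v)
    {W : Set ℝ → Ω' → ℂ} (hW : IsGaussianRandomMeasure P' volume W)
    {U₀ : ℝ → ℝ → Ω' → ℝ}
    (hU₀ : ∀ t, 0 < t → ∀ x, HasStochIntegral P' volume W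
      (fun l => ((√(A 0 * c2 (κ 0)) / (2 * √Real.pi) : ℝ) : ℂ) *
        (Complex.exp (Complex.I * (phase μ m t x l : ℂ)) /
            ((|l| ^ ((1 - κ 0) / 2) : ℝ) : ℂ) *
          ((Real.exp (-l ^ 2 / 4) : ℝ) : ℂ)))
      (fun ω => (U₀ t x ω : ℂ))) :
    TendstoFDD P P' (rescaledAverage P (κ 0) m v) (fun t x ω => 2 * Real.pi * c * U₀ t x ω) := by
  intro N t x ht
  refine tendstoInDistribution_of_inGaussianSpace hZ hW
    (X := fun (ε : Set.Ioi (0 : ℝ)) i => rescaledAverage P (κ 0) m v ε (t i) (x i))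
    (V := fun i ω => 2 * Real.pi * c * U₀ (t i) (x i) ω)
    (fun ε i => hv.inGaussianSpace_rescaledAverage hZ hmean_int (κ 0) ε.2 (ht i) (x i))
    (fun i => ((hU₀ (t i) (ht i) (x i)).inGaussianSpace hW).const_mul _) fun i j => ?_
  have h := ((tendsto_integral_comp_div hpar hF
    (continuous_averageKernel μ m (t i) (x i) (t j) (x j)).measurable
    (fun l => (norm_averageKernel _ _ _ _ _ _ l).le)).comp tendsto_sqrt_comap_Ioi).const_mul
    ((c ^ 2 * Real.pi : ℝ) : ℂ)
  have hlim : ((∫ ω, 2 * Real.pi * c * U₀ (t i) (x i) ω * (2 * Real.pi * c * U₀ (t j) (x j) ω)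
      ∂P' : ℝ) : ℂ) = ((c ^ 2 * Real.pi : ℝ) : ℂ) * ((A 0 * c2 (κ 0) : ℝ) *
        ∫ l, averageKernel μ m (t i) (x i) (t j) (x j) l * (|l| ^ (κ 0 - 1) : ℝ)) := by
    have h1 : ∫ ω, 2 * Real.pi * c * U₀ (t i) (x i) ω * (2 * Real.pi * c * U₀ (t j) (x j) ω) ∂P' =
        (2 * Real.pi * c) ^ 2 * ∫ ω, U₀ (t i) (x i) ω * U₀ (t j) (x j) ω ∂P' := by
      rw [← integral_const_mul]
      congr 1
      ext ω
      ring
    rw [h1, Complex.ofReal_mul, integral_limitField_mul hW (mul_c2_nonneg hpar hF)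
      (hpar.kappa_mem 0).2 (hU₀ _ (ht i) _) (hU₀ _ (ht j) _), ← mul_assoc, ← mul_assoc,
      ← Complex.ofReal_mul, ← Complex.ofReal_mul]
    congr 2
    field_simp
    ring
  rw [← hlim] at h
  refine ((Complex.continuous_re.tendsto _).comp h).congr fun ε => ?_
  simp only [Function.comp]
  rw [← hv.integral_rescaledAverage_mul hZ hmean_int (κ 0) ε.2 (ht i) (ht j), Complex.ofReal_re]
end

theorem theorem4p2
    {Ω Ω' : Type*} [MeasurableSpace Ω] [MeasurableSpace Ω']
    (P : Measure Ω) [IsProbabilityMeasure P] (P' : Measure Ω') [IsProbabilityMeasure P']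
    -- the equation
    (k m : ℕ) (hk : 1 ≤ k) (hm : m = 2 * k + 1) (μ : ℝ) (hμ : μ = 1 ∨ μ = -1)
    -- the random initial condition
    (F : Measure ℝ) [IsFiniteMeasure F] (Z : Set ℝ → Ω → ℂ) (hZ : IsGaussianRandomMeasure P F Z)
    (M : ℝ → ℝ) (η : ℝ → Ω → ℝ)
    (hη : ∀ x, HasStochIntegral P F Z
      (fun l => Complex.exp (Complex.I * ((l * x : ℝ) : ℂ)))
      (fun ω => ((η x ω - M x : ℝ) : ℂ)))
    -- its covariance function
    {n : ℕ} (A w κ : Fin (n + 1) → ℝ) (hpar : IsCyclicParameters A w κ) (hA : A 0 ≠ 0)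
    (hcov : ∀ y x, cov[η y, η (y + x); P] = cyclicCovariance A w κ x)
    -- the solution field; its mean exists and can be averaged with the Gaussian kernel
    (mean : ℝ → ℝ → ℝ) (hmean : IsMeanField μ m M mean)
    (hmean_int : ∀ t, 0 < t → ∀ ε, 0 < ε → ∀ x,
      Integrable (fun x₁ : ℝ => Real.exp (-(x₁ - x) ^ 2) * mean t (x₁ / √ε)))
    (u : ℝ → ℝ → Ω → ℝ) (hu : IsSolutionField P F Z (1 / (2 * Real.pi)) μ m mean u)
    -- the limit field, a stochastic integral with respect to the white noise `W`
    (W : Set ℝ → Ω' → ℂ) (hW : IsGaussianRandomMeasure P' volume W)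
    (U₀ : ℝ → ℝ → Ω' → ℝ)
    (hU₀ : ∀ t, 0 < t → ∀ x, HasStochIntegral P' volume W
      (fun l => ((√(A 0 * c2 (κ 0)) / (2 * √Real.pi) : ℝ) : ℂ) *
        (Complex.exp (Complex.I * (phase μ m t x l : ℂ)) /
            ((|l| ^ ((1 - κ 0) / 2) : ℝ) : ℂ) *
          ((Real.exp (-l ^ 2 / 4) : ℝ) : ℂ)))
      (fun ω => (U₀ t x ω : ℂ))) :
    TendstoFDD P P' (rescaledAverage P (κ 0) m u) U₀ ∧
    IsGaussianProcess (fun (p : Set.Ioi (0 : ℝ) × ℝ) ω => U₀ p.1 p.2 ω) P' ∧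
    (∀ t, 0 < t → ∀ x, ∫ ω, U₀ t x ω ∂P' = 0) ∧
    (∀ t, 0 < t → ∀ t', 0 < t' → ∀ x x',
      cov[U₀ t x, U₀ t' x'; P'] =
        A 0 * c2 (κ 0) / (4 * Real.pi) *
          ∫ l : ℝ, Real.cos (l * (x - x') + μ * (-1) ^ ((m - 1) / 2) * (t - t') * l ^ m) /
            |l| ^ (1 - κ 0) * Real.exp (-l ^ 2 / 2)) ∧
    -- the same for the solution without the factor `1 / (2π)` in the spectral integral
    (∀ v : ℝ → ℝ → Ω → ℝ, IsSolutionField P F Z 1 μ m mean v →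
      TendstoFDD P P' (rescaledAverage P (κ 0) m v)
        (fun t x ω => 2 * Real.pi * U₀ t x ω)) := by
  have hF := charFun_eq_cyclicCovariance hZ hη hcov
  have hG := fun t ht x => (hU₀ t ht x).inGaussianSpace hW
  refine ⟨?_, ?_, ?_, ?_, ?_⟩
  · have h := tendstoFDD_rescaledAverage hZ hpar hF hmean_int hu hW hU₀
    have h1 : 2 * Real.pi * (1 / (2 * Real.pi)) = 1 := by field_simp
    simpa only [h1, one_mul] using h
  · exact ⟨fun I => InGaussianSpace.hasGaussianLaw_pi hW
      (y := fun (i : I) ω => U₀ i.1.1 i.1.2 ω) fun i => hG _ i.1.1.2 _⟩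
  · exact fun t ht x => (hG t ht x).integral_eq_zero hW
  · intro t ht t' ht' x x'
    rw [(hG t ht x).covariance_eq hW (hG t' ht' x'),
      ← integral_averageKernel_mul_re (hpar.kappa_mem 0).1, ← Complex.re_ofReal_mul,
      ← integral_limitField_mul hW (mul_c2_nonneg hpar hF) (hpar.kappa_mem 0).2 (hU₀ t ht x)
        (hU₀ t' ht' x'), Complex.ofReal_re]
  · intro v hv
    simpa only [mul_one] using tendstoFDD_rescaledAverage hZ hpar hF hmean_int hv hW hU₀
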